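/- **Model.** Time is slotted, $t=0,1,2,\dots$. Features $i=0,1,2,\dots$ are sent one after another over a single channel from a buffer of size $B\ge 1$. Feature $i$ has length $l_i$ and position $b_i$ with $1\le l_i\le B$, $0\le b_i\le B-l_i$; it is submitted at time $S_i$ and delivered at time $D_i=S_i+T_i(l_i)$, where $S_0=0$, $l_0=1$, $b_0=0$ and $D_i\le S_{i+1}<\infty$. For $D_i\le t<D_{i+1}$ the age of information is $\Delta(t)=t-S_i+b_i$ and the current feature length is $d(t)=l_i$; for $t<D_0$ we put $\Delta(t)=\Delta_0+t$ and $d(t)=d_0$ with constants $\Delta_0\in\mathbb N$, $1\le d_0\le B$. The inference error is a function $\mathrm{err}(\delta,l)\in\mathbb R$ of age and feature length. A causal policy $\pi$ chooses $(S_{i+1},b_{i+1},l_{i+1})$ as a function of the transmission times of the features $0,\dots,i$. Let $\Pi_{\mathrm{inv}}=\bigcup_{l=1}^B\Pi_l$, where $\Pi_l$ is the set of causal policies with $l_1=l_2=\dots=l$, and $$\bar p_\pi=\limsup_{n\to\infty}\frac1n\,\mathbb E_\pi\Big[\sum_{t=0}^{n-1}\mathrm{err}(\Delta(t),d(t))\Big],\qquad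 \bar p_{\mathrm{inv}}=\inf_{\pi\in\Pi_{\mathrm{inv}}}\bar p_\pi ,$$ $$\gamma_l(\delta,d)=\inf_{\tau\in\{1,2,\dots\}}\frac1\tau\sum_{j=0}^{\tau-1}\mathbb E\big[\mathrm{err}(\delta+j+T_1(l),d)\big].$$ **Assumptions.** The integer-valued transmission times satisfy $T_i(l)\ge1$; for each $l\in\{1,\dots,B\}$ the $T_i(l)$, $i\ge 0$, are identically distributed with finite mean, and for every sequence of lengths $(l_i)$ in $\{1,\dots,B\}$ the variables $T_0(l_0),T_1(l_1),\dots$ are independent. The function $\mathrm{err}$ is bounded below, and $\mathbb E\big[\sum_{k<T_0(l)+T_1(l')+m}|\mathrm{err}(k,d)|\big]<\infty$ for all $l,l',d\in\{1,\dots,B\}$ and $m\in\mathbb N$ (automatic if $\mathrm{err}$ is bounded). Finally, sending is not worse than never sending again: for all $1\le l\le B$, $0\le b\le B-l$ there is a waiting rule $w:\mathbb N\to\mathbb N$ with $\mathbb E[w(T_0(l))]<\infty$ such that $\sum_{k<w(T_0(l))+T_1(l)}\mathrm{err}(T_0(l)+b+k,l)$ is integrable and $$\frac{\mathbb E\big[\sum_{k<w(T_0(l))+T_1(l)}\mathrm{err}(T_0(l)+b+k,l)\big]}{\mathbb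 E[w(T_0(l))+T_1(l)]}\le\liminf_{n\to\infty}\frac1n\sum_{k=0}^{n-1}\mathrm{err}(k,l).$$ **Theorem 1.** (i) For all $1\le l\le B$, $0\le b\le B-l$ there is exactly one real number $\beta=\beta_{b,l}$ for which the times $S_0(\beta)=0$, $D_i(\beta)=S_i(\beta)+T_i(l)$, $$S_{i+1}(\beta)=\min\{t\ge D_i(\beta):\ \gamma_l(\Delta_b(t),l)\ge\beta\},\qquad \Delta_b(t)=t-S_i(\beta)+b,$$ are almost surely well defined and, with finite expectations and for every $i$, $$\mathbb E\Big[\sum_{t=D_i(\beta)}^{D_{i+1}(\beta)-1}\mathrm{err}(\Delta_b(t),l)\Big]-\beta\,\mathbb E\big[D_{i+1}(\beta)-D_i(\beta)\big]=0 .$$ (ii) The optimal value is finite and $\displaystyle \bar p_{\mathrm{inv}}=\min_{1\le l\le B,\ 0\le b\le B-l}\beta_{b,l}$. (iii) For every minimizer $(l^*,b^*)$ of $\beta_{b,l}$ there is an optimal policy $\pi^*\in\Pi_{\mathrm{inv}}$, i.e. $\bar p_{\pi^*}=\bar p_{\mathrm{inv}}$, with $l_i=l^*$ and $b_i=b^*$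 for all $i\ge1$, whose sending times follow the threshold rule: almost surely, for every $i\ge1$ (and for $i=0$ too if $(l^*,b^*)=(1,0)$), the set below is nonempty and $$S^*_{i+1}=\min\{t\ge S^*_i+T_i(l^*):\ \gamma_{l^*}(t-S^*_i+b^*,l^*)\ge\bar p_{\mathrm{inv}}\}.$$ -/

import Mathlib

open MeasureTheory ProbabilityTheory Filter

namespace RemoteInference

/-- Feature length `l` and feature position `b` fit into a buffer of size `B`:
`1 ≤ l ≤ B` and `0 ≤ b ≤ B - l`. -/
def Admissible (B l b : ℕ) : Prop := 1 ≤ l ∧ b + l ≤ B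

/-- A causal signal-agnostic scheduling policy. When the channel has become idle after the
delivery of feature `i`, the information at the scheduler is the list of the transmission times of
the features `i, i-1, ..., 0` (most recent first; earlier decisions are functions of it, and nothing
new is learned while the channel stays idle). From it the policy fixes the waiting time before
feature `i + 1` is submitted, its position and its length. -/
structure Policy (B : ℕ) where
  wait : List ℕ → ℕ
  pos : List ℕ → ℕ
  len : List ℕ → ℕ
  admissible : ∀ h, Admissible B (len h) (pos h)

section Dynamics

variable {Ω : Type*} {B : ℕ} (T : ℕ → ℕ → Ω → ℕ) (π : Policy B) (ω : Ω)

/-- The transmission times of features `i, i-1, ..., 0`; the initial feature `0` has length `1`.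
`T i l ω` is the time needed to send feature `i` if its length is `l`. -/
def history : ℕ → List ℕ
  | 0 => [T 0 1 ω]
  | i + 1 => T (i + 1) (π.len (history i)) ω :: history i

/-- The length `l_i` of feature `i`, with `l_0 = 1`. -/
def featLen : ℕ → ℕ
  | 0 => 1
  | i + 1 => π.len (history T π ω i)

/-- The position `b_i` of feature `i`, with `b_0 = 0`. -/
def featPos : ℕ → ℕ
  | 0 => 0
  | i + 1 => π.pos (history T π ω i)

/-- The submission time `S_i` of feature `i`, with `S_0 = 0`. -/
def sendTime : ℕ → ℕ
  | 0 => 0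
  | i + 1 => sendTime i + T i (featLen T π ω i) ω + π.wait (history T π ω i)

/-- The delivery time `D_i = S_i + T_i(l_i)` of feature `i`. -/
def deliveryTime (i : ℕ) : ℕ := sendTime T π ω i + T i (featLen T π ω i) ω

/-- The index of the most recently delivered feature at time `t ≥ D_0` (transmission times are at
least one, so `i < D_i`, and the search can stop at `t`). -/
def lastDelivered (t : ℕ) : ℕ := Nat.findGreatest (fun i => deliveryTime T π ω i ≤ t) t

/-- The age of information: `t - S_i + b_i` for `D_i ≤ t < D_{i+1}`, and `Δ₀ + t` before the first
delivery. -/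
def aoi (Δ₀ t : ℕ) : ℕ :=
  if t < deliveryTime T π ω 0 then Δ₀ + t
  else t - sendTime T π ω (lastDelivered T π ω t) + featPos T π ω (lastDelivered T π ω t)

/-- The length `d(t)` of the most recently delivered feature, and `d₀` before the first delivery. -/
def currentLen (d₀ t : ℕ) : ℕ :=
  if t < deliveryTime T π ω 0 then d₀ else featLen T π ω (lastDelivered T π ω t)

end Dynamics

/-- The policies that give all features the same length `l`. -/
def fixedLengthPolicies (B l : ℕ) : Set (Policy B) := {π | ∀ h, π.len h = l}

/-- The policies with time-invariant feature length. -/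
def timeInvariantPolicies (B : ℕ) : Set (Policy B) :=
  {π | ∃ l, 1 ≤ l ∧ l ≤ B ∧ π ∈ fixedLengthPolicies B l}

noncomputable section

variable {Ω : Type*} [MeasurableSpace Ω] (P : Measure Ω) (err : ℕ → ℕ → ℝ) (T : ℕ → ℕ → Ω → ℕ)

/-- The time-averaged expected inference error of a policy. For each `t` the age at time `t` is
bounded, so the expectations are those of bounded random variables. -/
def avgError {B : ℕ} (Δ₀ d₀ : ℕ) (π : Policy B) : EReal :=
  limsup (fun n : ℕ => (((1 / (n : ℝ)) *
    ∫ ω, ∑ t ∈ Finset.range n, err (aoi T π ω Δ₀ t) (currentLen T π ω d₀ t) ∂P : ℝ) : EReal)) atTop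

/-- The optimal value over all policies with time-invariant feature length. -/
def optimalValue (B Δ₀ d₀ : ℕ) : EReal :=
  ⨅ π ∈ timeInvariantPolicies B, avgError P err T Δ₀ d₀ π

/-- The Gittins-like index
`γ_l(δ, d) = inf_{τ ≥ 1} (1 / τ) ∑_{j < τ} E[err(δ + j + T_1(l), d)]`. -/
def gittins (l δ d : ℕ) : ℝ :=
  ⨅ τ : ℕ+, (1 / ((τ : ℕ) : ℝ)) *
    ∑ j ∈ Finset.range (τ : ℕ), ∫ ω, err (δ + j + T 1 l ω) d ∂P

/-- If a feature of length `l` and position `b` was submitted at time `s` and delivered at time `D`: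
the times at which the threshold rule with threshold `x` allows the next submission. -/
def thresholdTimes (l b : ℕ) (x : ℝ) (s D : ℕ) : Set ℕ :=
  {t | D ≤ t ∧ x ≤ gittins P err T l (t - s + b) l}

/-- The submission times `S_i(x)` under the threshold rule with threshold `x`, for features of
constant length `l` and position `b`. -/
def thresholdSend (l b : ℕ) (x : ℝ) (ω : Ω) : ℕ → ℕ
  | 0 => 0
  | i + 1 => sInf (thresholdTimes P err T l b x (thresholdSend l b x ω i)
      (thresholdSend l b x ω i + T i l ω))

/-- The delivery times `D_i(x) = S_i(x) + T_i(l)` under the threshold rule. -/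
def thresholdDelivery (l b : ℕ) (x : ℝ) (ω : Ω) (i : ℕ) : ℕ :=
  thresholdSend P err T l b x ω i + T i l ω

/-- The accumulated error from the `i`-th to the `(i+1)`-st delivery under the threshold rule. -/
def cycleError (l b : ℕ) (x : ℝ) (i : ℕ) (ω : Ω) : ℝ :=
  ∑ t ∈ Finset.Ico (thresholdDelivery P err T l b x ω i) (thresholdDelivery P err T l b x ω (i + 1)),
    err (t - thresholdSend P err T l b x ω i + b) l

/-- The time from the `i`-th to the `(i+1)`-st delivery under the threshold rule. -/
def cycleLength (l b : ℕ) (x : ℝ) (i : ℕ) (ω : Ω) : ℝ :=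
  (thresholdDelivery P err T l b x ω (i + 1) : ℝ) - (thresholdDelivery P err T l b x ω i : ℝ)

/-- `x` solves `E[∑_{t = D_i(x)}^{D_{i+1}(x) - 1} err(Δ_b(t), l)] - x E[D_{i+1}(x) - D_i(x)] = 0`,
where the minimum that defines `S_{i+1}(x)` exists almost surely and both expectations are
finite. -/
def IsRenewalRoot (l b : ℕ) (x : ℝ) : Prop :=
  ∀ i : ℕ,
    (∀ᵐ ω ∂P, (thresholdTimes P err T l b x (thresholdSend P err T l b x ω i)
      (thresholdDelivery P err T l b x ω i)).Nonempty) ∧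
    Integrable (cycleError P err T l b x i) P ∧
    Integrable (cycleLength P err T l b x i) P ∧
    (∫ ω, cycleError P err T l b x i ω ∂P) - x * (∫ ω, cycleLength P err T l b x i ω ∂P) = 0

/-- The long-run average error if a feature of length `l` is kept forever. -/
def idleError (l : ℕ) : EReal :=
  liminf (fun n : ℕ => (((1 / (n : ℝ)) * ∑ k ∈ Finset.range n, err k l : ℝ) : EReal)) atTop

/-- Sending features of length `l` from position `b`, with some waiting time `w (T_i(l))` of finite
mean between delivery and next submission, has (as a renewal process) a finite average error that
is not larger than that of never sending again. -/
def WorthSending (l b : ℕ) : Prop :=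
  ∃ w : ℕ → ℕ,
    Integrable (fun ω => (w (T 0 l ω) : ℝ)) P ∧
    Integrable (fun ω => ∑ k ∈ Finset.range (w (T 0 l ω) + T 1 l ω), err (T 0 l ω + b + k) l) P ∧
    (((∫ ω, ∑ k ∈ Finset.range (w (T 0 l ω) + T 1 l ω), err (T 0 l ω + b + k) l ∂P) /
      (∫ ω, ((w (T 0 l ω) : ℝ) + (T 1 l ω : ℝ)) ∂P) : ℝ) : EReal) ≤ idleError err l

end

end RemoteInference

/-! Fix a length `l`, a position `b` and a price `x` per slot. A cycle lasts from one delivery to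
the next. If it starts at age δ and waits `w` slots before a transmission of duration Y, its mean
excess is E ∑_{k<w+Y} (err(δ+k,l) - x). One more slot of waiting adds E err(δ+w+Y,l) - x, so the
index at age δ+w is at least `x` exactly when no longer wait is better. Hence the first such `w` is
optimal among all waits (`meanExcess_optWait_le`), and the threshold rule minimises mean cost minus
`x` times mean length.

As in fractional programming, the root is the least ratio of mean cost to mean length (`rootValue`,
`isRoot_rootValue`). If a rule attains this ratio, its waits minimise the mean excess almost
everywhere, so the threshold is reached. Otherwise the assumption on sending puts the ratio strictly
below the idle error. Then the accumulated excess has positive linear drift even for prices slightly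
above the ratio, where threshold rules exist and have uniformly bounded mean length, and letting the
price decrease to the ratio gives the equation.

Upper bound (`avgError_le`): under the threshold policy the number of cycles begun before time n is
controlled by a Wald-type identity with truncated cycle lengths, and each cycle start is independent
of the excess in that cycle.

Lower bound (`le_avgError`): a general policy may use past-dependent positions and waits of infinite
mean, so its excess error is discounted by r < 1. For `x` below all roots, the drift and dominated
convergence make the discounted mean excess of a cycle nonnegative for all waiting rules
simultaneously, once r is near 1 (`eventually_discounted_nonneg`). Summing over cycles bounds the
total discounted excess from below uniformly in such r. An average error below some z < x would
instead force it below C - (x - z)/(1 - r), which tends to minus infinity. -/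

namespace RemoteInference

/-! ### One cycle: optimal waiting at a fixed price per slot. -/

section Cycle

/-- The law `μ` of a transmission time and the error `e` as a function of the age: `e` is bounded
below by `M`, and accumulates a finite mean over two independent transmissions. -/
structure IsServiceLaw (μ : Measure ℕ) (e : ℕ → ℝ) (M : ℝ) : Prop where
  pos : ∀ᵐ y ∂μ, 1 ≤ y
  mean : Integrable (fun y : ℕ => (y : ℝ)) μ
  lower : ∀ k, M ≤ e k
  cost : ∀ m, Integrable (fun p : ℕ × ℕ => ∑ k ∈ Finset.range (p.1 + p.2 + m), |e k|) (μ.prod μ)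

/-- The error in excess of `x`, accumulated over `N` slots from age `δ` on. -/
def excess (e : ℕ → ℝ) (x : ℝ) (δ N : ℕ) : ℝ := ∑ k ∈ Finset.range N, (e (δ + k) - x)

/-- The mean excess error if a transmission is started after `w` slots. -/
noncomputable def meanExcess (μ : Measure ℕ) (e : ℕ → ℝ) (x : ℝ) (δ w : ℕ) : ℝ :=
  ∫ y, excess e x δ (w + y) ∂μ

/-- The Gittins-like index in terms of the law of the transmission time. -/
noncomputable def lawIndex (μ : Measure ℕ) (e : ℕ → ℝ) (δ : ℕ) : ℝ :=
  ⨅ τ : ℕ+, (1 / ((τ : ℕ) : ℝ)) * ∑ j ∈ Finset.range (τ : ℕ), ∫ y, e (δ + j + y) ∂μ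

/-- The waiting time of the threshold rule from age `δ` on. -/
noncomputable def optWait (μ : Measure ℕ) (e : ℕ → ℝ) (x : ℝ) (δ : ℕ) : ℕ :=
  sInf {w | x ≤ lawIndex μ e (δ + w)}

theorem sum_abs_shift_le (e : ℕ → ℝ) {δ N K : ℕ} (h : δ + N ≤ K) :
    ∑ k ∈ Finset.range N, |e (δ + k)| ≤ ∑ k ∈ Finset.range K, |e k| := by
  calc ∑ k ∈ Finset.range N, |e (δ + k)|
      ≤ ∑ k ∈ Finset.range δ, |e k| + ∑ k ∈ Finset.range N, |e (δ + k)| :=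
        le_add_of_nonneg_left (Finset.sum_nonneg fun _ _ => abs_nonneg _)
    _ = ∑ k ∈ Finset.range (δ + N), |e k| := (Finset.sum_range_add _ _ _).symm
    _ ≤ _ := Finset.sum_le_sum_of_subset_of_nonneg (Finset.range_mono h)
        fun _ _ _ => abs_nonneg _

theorem excess_eq (e : ℕ → ℝ) (x : ℝ) (δ N : ℕ) :
    excess e x δ N = ∑ k ∈ Finset.range N, e (δ + k) - x * N := by
  simp [excess, Finset.sum_sub_distrib, mul_comm]

theorem abs_excess_le (e : ℕ → ℝ) (x : ℝ) {δ N K : ℕ} (h : δ + N ≤ K) :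
    |excess e x δ N| ≤ ∑ k ∈ Finset.range K, |e k| + |x| * N := by
  rw [excess_eq]
  refine (abs_sub _ _).trans (add_le_add ?_ ?_)
  · exact (Finset.abs_sum_le_sum_abs _ _).trans (sum_abs_shift_le e h)
  · rw [abs_mul, Nat.abs_cast]

theorem excess_change (e : ℕ → ℝ) (x x' : ℝ) (δ N : ℕ) :
    excess e x' δ N = excess e x δ N + (x - x') * N := by
  rw [excess_eq, excess_eq]; ring

variable {μ : Measure ℕ} [IsProbabilityMeasure μ] {e : ℕ → ℝ} {M : ℝ}

namespace IsServiceLaw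

variable (H : IsServiceLaw μ e M)
include H

theorem integrable_sum_abs (m : ℕ) :
    Integrable (fun y : ℕ => ∑ k ∈ Finset.range (y + m), |e k|) μ := by
  have h1 : Integrable (fun p : ℕ × ℕ => ∑ k ∈ Finset.range (p.1 + m), |e k|) (μ.prod μ) := by
    refine (H.cost m).mono' (by fun_prop) (.of_forall fun p => ?_)
    rw [Real.norm_of_nonneg (Finset.sum_nonneg fun _ _ => abs_nonneg _)]
    exact Finset.sum_le_sum_of_subset_of_nonneg (Finset.range_mono (by omega))
      fun _ _ _ => abs_nonneg _
  exact (measurePreserving_fst (μ := μ) (ν := μ)).integrable_comp (by fun_prop) |>.1 h1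

theorem integrable_err (δ : ℕ) : Integrable (fun y : ℕ => e (δ + y)) μ := by
  refine (H.integrable_sum_abs (δ + 1)).mono' (by fun_prop) (.of_forall fun y => ?_)
  exact Finset.single_le_sum (f := fun k => |e k|) (fun _ _ => abs_nonneg _)
    (Finset.mem_range.2 (by omega))

theorem integrable_excess (x : ℝ) (δ w : ℕ) :
    Integrable (fun y : ℕ => excess e x δ (w + y)) μ := by
  refine ((H.integrable_sum_abs (δ + w)).add
    (((integrable_const (w : ℝ)).add H.mean).const_mul |x|)).mono' (by fun_prop)
    (.of_forall fun y => ?_)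
  refine (abs_excess_le e x (K := y + (δ + w)) (by omega)).trans (le_of_eq ?_)
  simp

theorem integrable_excess_prod (x : ℝ) (b : ℕ) :
    Integrable (fun p : ℕ × ℕ => excess e x (p.1 + b) p.2) (μ.prod μ) := by
  refine ((H.cost b).add ((H.mean.comp_snd μ).const_mul |x|)).mono' (by fun_prop)
    (.of_forall fun p => ?_)
  exact (abs_excess_le e x (K := p.1 + p.2 + b) (by omega))

theorem meanExcess_change (x x' : ℝ) (δ w : ℕ) :
    meanExcess μ e x' δ w = meanExcess μ e x δ w + (x - x') * (w + ∫ y, (y : ℝ) ∂μ) := by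
  have h : ∀ y : ℕ, excess e x' δ (w + y) =
      excess e x δ (w + y) + (x - x') * ((w : ℝ) + y) := fun y => by
    rw [excess_change e x x']; push_cast; ring
  simp_rw [meanExcess, h]
  have hi : Integrable (fun y : ℕ => (w : ℝ) + y) μ := (integrable_const _).add H.mean
  rw [integral_add (H.integrable_excess x δ w) (hi.const_mul _), integral_const_mul,
    integral_add (integrable_const _) H.mean]
  simp

/-- An extra slot of waiting appends one term to the random sum, namely the error at age δ + w + Y.
These increments are the ones averaged in `lawIndex`. -/
theorem meanExcess_add (x : ℝ) (δ w τ : ℕ) :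
    meanExcess μ e x δ (w + τ) = meanExcess μ e x δ w
      + ∑ j ∈ Finset.range τ, ((∫ y, e (δ + w + j + y) ∂μ) - x) := by
  induction τ with
  | zero => simp
  | succ τ ih =>
    rw [Finset.sum_range_succ, ← add_assoc (meanExcess μ e x δ w), ← ih, ← add_assoc]
    have h : ∀ y : ℕ, excess e x δ (w + τ + 1 + y) =
        excess e x δ (w + τ + y) + (e (δ + w + τ + y) - x) := fun y => by
      rw [show w + τ + 1 + y = w + τ + y + 1 by ring, excess, Finset.sum_range_succ, ← excess]
      simp [add_assoc]
    simp_rw [meanExcess, h]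
    have hi : Integrable (fun y : ℕ => e (δ + w + τ + y) - x) μ :=
      (H.integrable_err _).sub (integrable_const _)
    rw [integral_add (H.integrable_excess x δ _) hi, integral_sub (H.integrable_err _)
      (integrable_const _)]
    simp

theorem bddBelow_index (δ : ℕ) : BddBelow (Set.range fun τ : ℕ+ =>
    (1 / ((τ : ℕ) : ℝ)) * ∑ j ∈ Finset.range (τ : ℕ), ∫ y, e (δ + j + y) ∂μ) := by
  refine ⟨M, ?_⟩
  rintro _ ⟨τ, rfl⟩
  have hτ : (0 : ℝ) < ((τ : ℕ) : ℝ) := by exact_mod_cast τ.pos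
  have h : ∑ j ∈ Finset.range (τ : ℕ), M ≤ ∑ j ∈ Finset.range (τ : ℕ), ∫ y, e (δ + j + y) ∂μ := by
    refine Finset.sum_le_sum fun j _ => ?_
    calc M = ∫ _, M ∂μ := by simp
      _ ≤ _ := integral_mono (integrable_const _) (H.integrable_err _) fun y => H.lower _
  simp only [Finset.sum_const, Finset.card_range, nsmul_eq_mul] at h
  dsimp only
  rw [one_div, inv_mul_eq_div, le_div_iff₀ hτ]
  linarith

/-- The index is the infimum of averages of consecutive increments of the mean excess, so comparing
it with `x` is comparing the current wait with every longer one. -/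
theorem le_lawIndex_iff (x : ℝ) (δ w : ℕ) :
    x ≤ lawIndex μ e (δ + w) ↔ ∀ τ, meanExcess μ e x δ w ≤ meanExcess μ e x δ (w + τ) := by
  rw [lawIndex, le_ciInf_iff (H.bddBelow_index _)]
  have key : ∀ τ : ℕ+, x ≤ (1 / ((τ : ℕ) : ℝ)) *
      ∑ j ∈ Finset.range (τ : ℕ), ∫ y, e (δ + w + j + y) ∂μ ↔
      meanExcess μ e x δ w ≤ meanExcess μ e x δ (w + τ) := fun τ => by
    have hτ : (0 : ℝ) < ((τ : ℕ) : ℝ) := by exact_mod_cast τ.pos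
    rw [H.meanExcess_add, one_div, inv_mul_eq_div, le_div_iff₀ hτ, le_add_iff_nonneg_right,
      Finset.sum_sub_distrib, sub_nonneg]
    simp [mul_comm]
  constructor
  · intro h τ
    rcases Nat.eq_zero_or_pos τ with rfl | hτ
    · simp
    · exact (key ⟨τ, hτ⟩).1 (h ⟨τ, hτ⟩)
  · exact fun h τ => (key τ).2 (h τ)

/-- The threshold rule minimises the mean excess error. -/
theorem meanExcess_optWait_le {x : ℝ} {δ : ℕ} (hne : {w | x ≤ lawIndex μ e (δ + w)}.Nonempty)
    (w : ℕ) : meanExcess μ e x δ (optWait μ e x δ) ≤ meanExcess μ e x δ w := by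
  have hmem : x ≤ lawIndex μ e (δ + optWait μ e x δ) := Nat.sInf_mem hne
  rw [H.le_lawIndex_iff] at hmem
  rcases le_or_gt (optWait μ e x δ) w with h | h
  · obtain ⟨τ, rfl⟩ := Nat.exists_eq_add_of_le h
    exact hmem τ
  · induction hn : optWait μ e x δ - w using Nat.strong_induction_on generalizing w with
    | _ n ih =>
      have hw := Nat.notMem_of_lt_sInf h
      rw [Set.mem_ofPred_eq, H.le_lawIndex_iff] at hw
      push Not at hw
      obtain ⟨τ, hτ⟩ := hw
      refine le_trans ?_ hτ.le
      rcases le_or_gt (optWait μ e x δ) (w + τ) with h' | h'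
      · obtain ⟨τ', h''⟩ := Nat.exists_eq_add_of_le h'
        rw [h'']
        exact hmem τ'
      · have : τ ≠ 0 := by rintro rfl; simp at hτ
        exact ih _ (by omega) (w + τ) h' rfl

theorem le_lawIndex_of_forall_le {x : ℝ} {δ w : ℕ}
    (h : ∀ w', meanExcess μ e x δ w ≤ meanExcess μ e x δ w') : x ≤ lawIndex μ e (δ + w) :=
  (H.le_lawIndex_iff x δ w).2 fun _ => h _

end IsServiceLaw

omit [IsProbabilityMeasure μ] in
theorem optWait_le {x : ℝ} {δ w : ℕ} (h : x ≤ lawIndex μ e (δ + w)) : optWait μ e x δ ≤ w :=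
  Nat.sInf_le h

omit [IsProbabilityMeasure μ] in
theorem optWait_mono {x x' : ℝ} (hx : x ≤ x') {δ : ℕ}
    (hne : {w | x' ≤ lawIndex μ e (δ + w)}.Nonempty) : optWait μ e x δ ≤ optWait μ e x' δ :=
  optWait_le (hx.trans (Nat.sInf_mem hne : x' ≤ _))

/-- The accumulated excess of `e` over `x` grows at a linear rate. -/
def HasDrift (e : ℕ → ℝ) (x : ℝ) : Prop :=
  ∃ ε > 0, ∃ C ≥ 0, ∀ n : ℕ, ε * n - C ≤ ∑ k ∈ Finset.range n, (e k - x)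

theorem hasDrift_of_lt_liminf {x : ℝ} (h : (x : EReal) < liminf (fun n : ℕ =>
    (((1 / (n : ℝ)) * ∑ k ∈ Finset.range n, e k : ℝ) : EReal)) atTop) : HasDrift e x := by
  obtain ⟨z, hxz, hz⟩ := EReal.lt_iff_exists_real_btwn.1 h
  have hxz' : x < z := by exact_mod_cast hxz
  obtain ⟨N, hN⟩ := eventually_atTop.1 (eventually_lt_of_lt_liminf hz)
  -- The rate comes from a level `z` strictly between `x` and the liminf; the constant absorbs the
  -- finitely many `n ≤ N` at which the average may still be below `z`.
  refine ⟨z - x, sub_pos.2 hxz', ∑ n ∈ Finset.range (N + 1),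
    |(z - x) * n - ∑ k ∈ Finset.range n, (e k - x)|,
    Finset.sum_nonneg fun _ _ => abs_nonneg _, fun n => ?_⟩
  rcases le_or_gt n N with hn | hn
  · have := Finset.single_le_sum (f := fun n : ℕ =>
      |(z - x) * n - ∑ k ∈ Finset.range n, (e k - x)|) (fun _ _ => abs_nonneg _)
      (Finset.mem_range.2 (Nat.lt_succ_of_le hn))
    have h2 := le_abs_self ((z - x) * n - ∑ k ∈ Finset.range n, (e k - x))
    linarith
  · have hpos : (0 : ℝ) < n := by exact_mod_cast (by omega : 0 < n)
    have h1 : z < 1 / (n : ℝ) * ∑ k ∈ Finset.range n, e k := by exact_mod_cast hN n hn.le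
    rw [one_div, inv_mul_eq_div, lt_div_iff₀ hpos] at h1
    have h2 : 0 ≤ ∑ n ∈ Finset.range (N + 1),
      |(z - x) * n - ∑ k ∈ Finset.range n, (e k - x)| := Finset.sum_nonneg fun _ _ => abs_nonneg _
    rw [Finset.sum_sub_distrib]
    simp only [Finset.sum_const, Finset.card_range, nsmul_eq_mul]
    linarith

theorem le_excess_of_drift {x ε C : ℝ} (hε : 0 ≤ ε)
    (hd : ∀ n : ℕ, ε * n - C ≤ ∑ k ∈ Finset.range n, (e k - x)) (δ N : ℕ) :
    ε * N - (C + ∑ k ∈ Finset.range δ, |e k - x|) ≤ excess e x δ N := by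
  have h1 := hd (δ + N)
  rw [Finset.sum_range_add] at h1
  have h2 : ∑ k ∈ Finset.range δ, (e k - x) ≤ ∑ k ∈ Finset.range δ, |e k - x| :=
    Finset.sum_le_sum fun _ _ => le_abs_self _
  have h3 : 0 ≤ ε * δ := by positivity
  push_cast at h1
  rw [excess]
  linarith

theorem IsServiceLaw.integrable_sum_abs_sub (H : IsServiceLaw μ e M) (x : ℝ) (b : ℕ) :
    Integrable (fun y : ℕ => ∑ k ∈ Finset.range (y + b), |e k - x|) μ := by
  refine ((H.integrable_sum_abs b).add
    ((H.mean.add (integrable_const (b : ℝ))).const_mul |x|)).mono' (by fun_prop)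
    (.of_forall fun y => ?_)
  rw [Real.norm_of_nonneg (Finset.sum_nonneg fun _ _ => abs_nonneg _)]
  refine (Finset.sum_le_sum fun k _ => abs_sub (e k) x).trans (le_of_eq ?_)
  rw [Finset.sum_add_distrib]
  simp [mul_comm]

theorem IsServiceLaw.le_meanExcess_of_drift (H : IsServiceLaw μ e M) {x ε C : ℝ} (hε : 0 ≤ ε)
    (hd : ∀ n : ℕ, ε * n - C ≤ ∑ k ∈ Finset.range n, (e k - x)) (δ w : ℕ) :
    ε * w - (C + ∑ k ∈ Finset.range δ, |e k - x|) ≤ meanExcess μ e x δ w := by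
  calc ε * w - (C + ∑ k ∈ Finset.range δ, |e k - x|)
      = ∫ _, (ε * w - (C + ∑ k ∈ Finset.range δ, |e k - x|)) ∂μ := by simp
    _ ≤ _ := integral_mono (integrable_const _) (H.integrable_excess x δ w) fun y => ?_
  refine le_trans ?_ (le_excess_of_drift hε hd δ (w + y))
  have : 0 ≤ ε * y := by positivity
  push_cast
  linarith

/-- By the drift, waits beyond some `K` are worse than not waiting, so a minimiser over a finite
range is a global one, and the index at a global minimiser is at least `x`. -/
theorem IsServiceLaw.nonempty_of_drift (H : IsServiceLaw μ e M) {x : ℝ} (hx : HasDrift e x)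
    (δ : ℕ) : {w | x ≤ lawIndex μ e (δ + w)}.Nonempty := by
  obtain ⟨ε, hε, C, -, hd⟩ := hx
  obtain ⟨K, hK⟩ := exists_nat_gt
    ((meanExcess μ e x δ 0 + (C + ∑ k ∈ Finset.range δ, |e k - x|)) / ε)
  rw [div_lt_iff₀ hε] at hK
  obtain ⟨w, hw, hmin⟩ := Finset.exists_min_image (Finset.range (K + 1)) (meanExcess μ e x δ)
    ⟨0, by simp⟩
  refine ⟨w, H.le_lawIndex_of_forall_le fun w' => ?_⟩
  rcases lt_or_ge w' (K + 1) with h | h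
  · exact hmin _ (Finset.mem_range.2 h)
  · refine (hmin 0 (by simp)).trans ?_
    have h1 := H.le_meanExcess_of_drift hε.le hd δ w'
    have h2 : ε * K ≤ ε * w' := by
      have : (K : ℝ) ≤ w' := by exact_mod_cast (by omega : K ≤ w')
      gcongr
    linarith

theorem IsServiceLaw.integrable_meanExcess_zero (H : IsServiceLaw μ e M) (x : ℝ) (b : ℕ) :
    Integrable (fun y : ℕ => meanExcess μ e x (y + b) 0) μ := by
  simpa [meanExcess] using (H.integrable_excess_prod x b).integral_prod_left

/-- The drift bounds ε times the wait by its mean excess plus a remainder, and the optimal mean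
excess is at most that of not waiting, which is integrable. -/
theorem IsServiceLaw.integrable_optWait (H : IsServiceLaw μ e M) {x : ℝ} (hx : HasDrift e x)
    (b : ℕ) : Integrable (fun y : ℕ => (optWait μ e x (y + b) : ℝ)) μ := by
  have hne := fun δ => H.nonempty_of_drift hx δ
  obtain ⟨ε, hε, C, hC, hd⟩ := hx
  refine (((H.integrable_meanExcess_zero x b).add ((integrable_const C).add
    (H.integrable_sum_abs_sub x b))).const_mul ε⁻¹).mono' (by fun_prop) (.of_forall fun y => ?_)
  have h1 := H.le_meanExcess_of_drift hε.le hd (y + b) (optWait μ e x (y + b))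
  have h2 := H.meanExcess_optWait_le (hne (y + b)) 0
  rw [Real.norm_of_nonneg (by positivity), inv_mul_eq_div, le_div_iff₀ hε]
  simp only [Pi.add_apply]
  linarith

/-- Waiting rules with a finite mean waiting time and a finite mean error per cycle. -/
def Feasible (μ : Measure ℕ) (e : ℕ → ℝ) (b : ℕ) (w : ℕ → ℕ) : Prop :=
  Integrable (fun y => (w y : ℝ)) μ ∧
  Integrable (fun p : ℕ × ℕ => ∑ k ∈ Finset.range (w p.1 + p.2), e (p.1 + b + k)) (μ.prod μ)

/-- The mean error per cycle. -/
noncomputable def meanCost (μ : Measure ℕ) (e : ℕ → ℝ) (b : ℕ) (w : ℕ → ℕ) : ℝ :=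
  ∫ p : ℕ × ℕ, ∑ k ∈ Finset.range (w p.1 + p.2), e (p.1 + b + k) ∂(μ.prod μ)

/-- The mean length of a cycle. -/
noncomputable def meanLength (μ : Measure ℕ) (w : ℕ → ℕ) : ℝ :=
  ∫ p : ℕ × ℕ, ((w p.1 : ℝ) + (p.2 : ℝ)) ∂(μ.prod μ)

theorem IsServiceLaw.integrable_length (H : IsServiceLaw μ e M) {w : ℕ → ℕ}
    (hw : Integrable (fun y => (w y : ℝ)) μ) :
    Integrable (fun p : ℕ × ℕ => (w p.1 : ℝ) + (p.2 : ℝ)) (μ.prod μ) :=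
  (hw.comp_fst μ).add (H.mean.comp_snd μ)

theorem IsServiceLaw.one_le_meanLength (H : IsServiceLaw μ e M) {w : ℕ → ℕ}
    (hw : Integrable (fun y => (w y : ℝ)) μ) : 1 ≤ meanLength μ w := by
  have h : ∀ᵐ p ∂(μ.prod μ), 1 ≤ p.2 :=
    (Measure.quasiMeasurePreserving_snd (μ := μ) (ν := μ)).ae H.pos
  calc (1 : ℝ) = ∫ _, 1 ∂(μ.prod μ) := by simp
    _ ≤ _ := integral_mono_ae (integrable_const _) (H.integrable_length hw) ?_
  filter_upwards [h] with p hp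
  have : (1 : ℝ) ≤ p.2 := by exact_mod_cast hp
  have : (0 : ℝ) ≤ w p.1 := by positivity
  linarith

theorem IsServiceLaw.meanLength_mono (H : IsServiceLaw μ e M) {w w' : ℕ → ℕ}
    (hw : Integrable (fun y => (w y : ℝ)) μ) (hw' : Integrable (fun y => (w' y : ℝ)) μ)
    (h : ∀ y, w y ≤ w' y) : meanLength μ w ≤ meanLength μ w' :=
  integral_mono (H.integrable_length hw) (H.integrable_length hw') fun p => by
    have : (w p.1 : ℝ) ≤ w' p.1 := by exact_mod_cast h p.1
    simpa using this

theorem IsServiceLaw.integrable_excess_of_feasible (H : IsServiceLaw μ e M) {b : ℕ} {w : ℕ → ℕ}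
    (hw : Feasible μ e b w) (x : ℝ) :
    Integrable (fun p : ℕ × ℕ => excess e x (p.1 + b) (w p.1 + p.2)) (μ.prod μ) := by
  refine (hw.2.sub ((H.integrable_length hw.1).const_mul x)).congr (.of_forall fun p => ?_)
  simp [excess_eq]

theorem IsServiceLaw.integral_excess (H : IsServiceLaw μ e M) {b : ℕ} {w : ℕ → ℕ}
    (hw : Feasible μ e b w) (x : ℝ) :
    ∫ p : ℕ × ℕ, excess e x (p.1 + b) (w p.1 + p.2) ∂(μ.prod μ)
      = meanCost μ e b w - x * meanLength μ w := by
  rw [meanCost, meanLength, ← integral_const_mul, ← integral_sub hw.2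
    ((H.integrable_length hw.1).const_mul x)]
  exact integral_congr_ae (.of_forall fun p => by simp [excess_eq])

theorem IsServiceLaw.integrable_meanExcess (H : IsServiceLaw μ e M) {b : ℕ} {w : ℕ → ℕ}
    (hw : Feasible μ e b w) (x : ℝ) :
    Integrable (fun y => meanExcess μ e x (y + b) (w y)) μ :=
  (H.integrable_excess_of_feasible hw x).integral_prod_left

theorem IsServiceLaw.integral_meanExcess (H : IsServiceLaw μ e M) {b : ℕ} {w : ℕ → ℕ}
    (hw : Feasible μ e b w) (x : ℝ) :
    ∫ y, meanExcess μ e x (y + b) (w y) ∂μ = meanCost μ e b w - x * meanLength μ w := by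
  rw [← H.integral_excess hw, integral_prod _ (H.integrable_excess_of_feasible hw x)]
  rfl

/-- The excess over the lower bound `M` is nonnegative, so by Tonelli an integrable upper bound for
its mean given `y` suffices. Passing from the price `x` to `M` changes that mean only by a multiple
of the mean cycle length. -/
theorem IsServiceLaw.feasible_of_le (H : IsServiceLaw μ e M) {b : ℕ} {w : ℕ → ℕ} {x : ℝ}
    {f : ℕ → ℝ} (hw : Integrable (fun y => (w y : ℝ)) μ) (hf : Integrable f μ)
    (hle : ∀ᵐ y ∂μ, meanExcess μ e x (y + b) (w y) ≤ f y) : Feasible μ e b w := by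
  refine ⟨hw, ?_⟩
  have h0 : ∀ δ N, 0 ≤ excess e M δ N := fun δ N =>
    Finset.sum_nonneg fun k _ => sub_nonneg.2 (H.lower _)
  have h1 : Integrable (fun p : ℕ × ℕ => excess e M (p.1 + b) (w p.1 + p.2)) (μ.prod μ) := by
    refine (integrable_prod_iff Measurable.of_discrete.aestronglyMeasurable).2
      ⟨.of_forall fun y => H.integrable_excess M (y + b) (w y), ?_⟩
    refine (hf.abs.add ((hw.add (integrable_const (∫ y, (y : ℝ) ∂μ))).const_mul |x - M|)).mono'
      Measurable.of_discrete.aestronglyMeasurable ?_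
    filter_upwards [hle] with y hy
    have h2 : (fun y' : ℕ => ‖excess e M (y + b) (w y + y')‖) =
        fun y' : ℕ => excess e M (y + b) (w y + y') :=
      funext fun y' => Real.norm_of_nonneg (h0 _ _)
    simp only [h2]
    rw [Real.norm_of_nonneg (integral_nonneg fun y' => h0 _ _)]
    change meanExcess μ e M (y + b) (w y) ≤ _
    rw [H.meanExcess_change x M]
    have h3 : 0 ≤ (w y : ℝ) + ∫ y, (y : ℝ) ∂μ :=
      add_nonneg (by positivity) (integral_nonneg fun y => by positivity)
    have h4 := mul_le_mul_of_nonneg_right (le_abs_self (x - M)) h3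
    have h5 := le_abs_self (f y)
    simp only [Pi.add_apply]
    linarith
  refine (h1.add ((H.integrable_length hw).const_mul M)).congr (.of_forall fun p => ?_)
  simp [excess_eq]

theorem IsServiceLaw.feasible_zero (H : IsServiceLaw μ e M) (b : ℕ) :
    Feasible μ e b fun _ => 0 :=
  H.feasible_of_le (x := 0) (f := fun y => meanExcess μ e 0 (y + b) 0) (by simp)
    (H.integrable_meanExcess_zero 0 b) (.of_forall fun _ => le_rfl)

theorem IsServiceLaw.feasible_optWait (H : IsServiceLaw μ e M) {x : ℝ} {b : ℕ}
    (hne : ∀ᵐ y ∂μ, {w | x ≤ lawIndex μ e (y + b + w)}.Nonempty)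
    (hw : Integrable (fun y : ℕ => (optWait μ e x (y + b) : ℝ)) μ) :
    Feasible μ e b fun y => optWait μ e x (y + b) :=
  H.feasible_of_le (f := fun y => meanExcess μ e x (y + b) 0) hw (H.integrable_meanExcess_zero x b)
    (hne.mono fun _ hy => H.meanExcess_optWait_le hy 0)

/-- Optimality for each age integrates over the age at delivery; this is the fractional-programming
step that links the index to ratios. -/
theorem IsServiceLaw.optimal_optWait (H : IsServiceLaw μ e M) {x : ℝ} {b : ℕ} {w : ℕ → ℕ}
    (hne : ∀ᵐ y ∂μ, {w | x ≤ lawIndex μ e (y + b + w)}.Nonempty)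
    (hopt : Feasible μ e b fun y => optWait μ e x (y + b)) (hw : Feasible μ e b w) :
    meanCost μ e b (fun y => optWait μ e x (y + b))
      - x * meanLength μ (fun y => optWait μ e x (y + b))
      ≤ meanCost μ e b w - x * meanLength μ w := by
  rw [← H.integral_meanExcess hopt, ← H.integral_meanExcess hw]
  exact integral_mono_ae (H.integrable_meanExcess hopt x) (H.integrable_meanExcess hw x)
    (hne.mono fun y hy => H.meanExcess_optWait_le hy _)

end Cycle

/-! ### Existence and uniqueness of the root. -/

section Root

variable {μ : Measure ℕ} [IsProbabilityMeasure μ] {e : ℕ → ℝ} {M : ℝ}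

/-- The threshold rule with threshold `x` is feasible and its mean excess error vanishes. -/
def IsRoot (μ : Measure ℕ) (e : ℕ → ℝ) (b : ℕ) (x : ℝ) : Prop :=
  (∀ᵐ y ∂μ, {w | x ≤ lawIndex μ e (y + b + w)}.Nonempty) ∧
  Feasible μ e b (fun y => optWait μ e x (y + b)) ∧
  meanCost μ e b (fun y => optWait μ e x (y + b))
    - x * meanLength μ (fun y => optWait μ e x (y + b)) = 0

/-- The least average error of a feasible waiting rule. -/
noncomputable def rootValue (μ : Measure ℕ) (e : ℕ → ℝ) (b : ℕ) : ℝ :=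
  sInf {ρ | ∃ w, Feasible μ e b w ∧ ρ = meanCost μ e b w / meanLength μ w}

namespace IsServiceLaw

variable (H : IsServiceLaw μ e M)
include H

theorem meanLength_pos {w : ℕ → ℕ} (hw : Integrable (fun y => (w y : ℝ)) μ) :
    0 < meanLength μ w := zero_lt_one.trans_le (H.one_le_meanLength hw)

/-- At price `z` the rule of the root `z` is optimal with value zero, so the rule of another root
`z'` has nonnegative value there. That rule breaks even at price `z'`, and its mean length is
positive, hence `z ≤ z'`. -/
theorem root_unique {b : ℕ} {x x' : ℝ} (hx : IsRoot μ e b x) (hx' : IsRoot μ e b x') :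
    x = x' := by
  have aux : ∀ {z z'}, IsRoot μ e b z → IsRoot μ e b z' → z ≤ z' := fun {z z'} hz hz' => by
    have h := H.optimal_optWait hz.1 hz.2.1 hz'.2.1
    rw [hz.2.2] at h
    have h2 := hz'.2.2
    have h3 := H.meanLength_pos hz'.2.1.1
    by_contra! hlt
    nlinarith
  exact le_antisymm (aux hx hx') (aux hx' hx)

theorem mul_meanLength_le {b : ℕ} {w : ℕ → ℕ} (hw : Feasible μ e b w) :
    M * meanLength μ w ≤ meanCost μ e b w := by
  have h := H.integral_excess hw M
  have h2 : 0 ≤ ∫ p : ℕ × ℕ, excess e M (p.1 + b) (w p.1 + p.2) ∂(μ.prod μ) :=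
    integral_nonneg fun p => Finset.sum_nonneg fun k _ => sub_nonneg.2 (H.lower _)
  linarith

theorem bddBelow_ratio (b : ℕ) :
    BddBelow {ρ | ∃ w, Feasible μ e b w ∧ ρ = meanCost μ e b w / meanLength μ w} := by
  refine ⟨M, ?_⟩
  rintro _ ⟨w, hw, rfl⟩
  rw [le_div_iff₀ (H.meanLength_pos hw.1)]
  exact H.mul_meanLength_le hw

theorem ratio_nonempty (b : ℕ) :
    {ρ | ∃ w, Feasible μ e b w ∧ ρ = meanCost μ e b w / meanLength μ w}.Nonempty :=
  ⟨_, _, H.feasible_zero b, rfl⟩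

theorem rootValue_mul_le {b : ℕ} {w : ℕ → ℕ} (hw : Feasible μ e b w) :
    rootValue μ e b * meanLength μ w ≤ meanCost μ e b w := by
  rw [← le_div_iff₀ (H.meanLength_pos hw.1)]
  exact csInf_le (H.bddBelow_ratio b) ⟨w, hw, rfl⟩

theorem rootValue_le_liminf {b : ℕ}
    (hW : ∃ w, Feasible μ e b w ∧ ((meanCost μ e b w / meanLength μ w : ℝ) : EReal) ≤
      liminf (fun n : ℕ =>
        (((1 / (n : ℝ)) * ∑ k ∈ Finset.range n, e k : ℝ) : EReal)) atTop) :
    ((rootValue μ e b : ℝ) : EReal) ≤ liminf (fun n : ℕ =>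
        (((1 / (n : ℝ)) * ∑ k ∈ Finset.range n, e k : ℝ) : EReal)) atTop := by
  obtain ⟨w, hw, hle⟩ := hW
  refine le_trans ?_ hle
  exact_mod_cast csInf_le (H.bddBelow_ratio b) ⟨w, hw, rfl⟩

/-- Below the root, the threshold rule has a positive mean excess error. -/
theorem meanExcess_pos_of_lt_rootValue {b : ℕ} {x : ℝ} (hx : HasDrift e x)
    (hlt : x < rootValue μ e b) :
    Feasible μ e b (fun y => optWait μ e x (y + b)) ∧
    0 < ∫ y, meanExcess μ e x (y + b) (optWait μ e x (y + b)) ∂μ := by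
  have hf : Feasible μ e b (fun y => optWait μ e x (y + b)) :=
    H.feasible_optWait (.of_forall fun y => H.nonempty_of_drift hx (y + b))
      (H.integrable_optWait hx b)
  refine ⟨hf, ?_⟩
  rw [H.integral_meanExcess hf]
  have h1 := H.rootValue_mul_le hf
  have h2 := H.meanLength_pos hf.1
  nlinarith

/-- The case in which a feasible rule attains the least average error. -/
theorem isRoot_of_attained {b : ℕ} {w : ℕ → ℕ} (hw : Feasible μ e b w)
    (hle : meanCost μ e b w / meanLength μ w ≤ rootValue μ e b) :
    IsRoot μ e b (rootValue μ e b) := by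
  set β := rootValue μ e b
  rw [div_le_iff₀ (H.meanLength_pos hw.1)] at hle
  have hmin : ∀ᵐ y ∂μ, ∀ v, meanExcess μ e β (y + b) (w y) ≤ meanExcess μ e β (y + b) v := by
    -- There are only countably many competing waits `v`. Switching to `v` wherever it is strictly
    -- better stays feasible and cannot lower the ratio below its infimum, so the integrated gain is
    -- zero and the gain vanishes almost everywhere.
    refine ae_all_iff.2 fun v => ?_
    classical
    let w' : ℕ → ℕ := fun y =>
      if meanExcess μ e β (y + b) v < meanExcess μ e β (y + b) (w y) then v else w y
    have hw'le : ∀ y, meanExcess μ e β (y + b) (w' y) ≤ meanExcess μ e β (y + b) (w y) :=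
      fun y => by
        simp only [w']
        split_ifs with h
        · exact h.le
        · exact le_rfl
    have hw'int : Integrable (fun y => (w' y : ℝ)) μ := by
      refine (hw.1.add (integrable_const (v : ℝ))).mono' (by fun_prop) (.of_forall fun y => ?_)
      rw [Real.norm_of_nonneg (by positivity)]
      simp only [w', Pi.add_apply]
      split_ifs
      · simp
      · simp
    have hw' : Feasible μ e b w' :=
      H.feasible_of_le hw'int (H.integrable_meanExcess hw β) (.of_forall hw'le)
    have h1 := H.integral_meanExcess hw β
    have h2 := H.integral_meanExcess hw' β
    have h3 := H.rootValue_mul_le hw'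
    have h0 : ∫ y, (meanExcess μ e β (y + b) (w y) - meanExcess μ e β (y + b) (w' y)) ∂μ = 0 := by
      refine le_antisymm ?_ (integral_nonneg fun y => sub_nonneg.2 (hw'le y))
      rw [integral_sub (H.integrable_meanExcess hw β) (H.integrable_meanExcess hw' β)]
      linarith
    rw [integral_eq_zero_iff_of_nonneg (fun y => sub_nonneg.2 (hw'le y))
      ((H.integrable_meanExcess hw β).sub (H.integrable_meanExcess hw' β))] at h0
    filter_upwards [h0] with y hy
    by_contra! hlt
    have : w' y = v := if_pos hlt
    simp only [this, Pi.zero_apply] at hy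
    linarith
  have hmem : ∀ᵐ y ∂μ, β ≤ lawIndex μ e (y + b + w y) :=
    hmin.mono fun y hy => H.le_lawIndex_of_forall_le hy
  have hne : ∀ᵐ y ∂μ, {v | β ≤ lawIndex μ e (y + b + v)}.Nonempty :=
    hmem.mono fun y hy => ⟨w y, hy⟩
  have hint : Integrable (fun y : ℕ => (optWait μ e β (y + b) : ℝ)) μ := by
    refine hw.1.mono' (by fun_prop) (hmem.mono fun y hy => ?_)
    rw [Real.norm_of_nonneg (by positivity)]
    exact_mod_cast optWait_le hy
  have hf := H.feasible_optWait hne hint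
  refine ⟨hne, hf, le_antisymm ?_ (sub_nonneg.2 (H.rootValue_mul_le hf))⟩
  have := H.optimal_optWait hne hf hw
  linarith

/-- The case in which the least average error is below that of never sending again. -/
theorem isRoot_of_lt_liminf {b : ℕ} (hlt : ((rootValue μ e b : ℝ) : EReal) < liminf (fun n : ℕ =>
      (((1 / (n : ℝ)) * ∑ k ∈ Finset.range n, e k : ℝ) : EReal)) atTop) :
    IsRoot μ e b (rootValue μ e b) := by
  set β := rootValue μ e b
  obtain ⟨z, hβz, hz⟩ := EReal.lt_iff_exists_real_btwn.1 hlt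
  have hβz' : β < z := by exact_mod_cast hβz
  have hdrift : ∀ x ≤ z, HasDrift e x := fun x hx =>
    hasDrift_of_lt_liminf (lt_of_le_of_lt (by exact_mod_cast hx) hz)
  have hne : ∀ x ≤ z, ∀ δ, {w | x ≤ lawIndex μ e (δ + w)}.Nonempty :=
    fun x hx => H.nonempty_of_drift (hdrift x hx)
  have hf : ∀ x ≤ z, Feasible μ e b (fun y => optWait μ e x (y + b)) := fun x hx =>
    H.feasible_optWait (.of_forall fun y => hne x hx (y + b)) (H.integrable_optWait (hdrift x hx) b)
  refine ⟨.of_forall fun y => hne β hβz'.le (y + b), hf β hβz'.le,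
    le_antisymm ?_ (sub_nonneg.2 (H.rootValue_mul_le (hf β hβz'.le)))⟩
  -- Threshold waits increase with the price, so `L` bounds the mean cycle length for all prices up
  -- to `z`. This allows `x` above `β` with the error term (x - β) L at most `η`.
  set L := meanLength μ (fun y => optWait μ e z (y + b)) with hL
  have hLpos : 0 < L := H.meanLength_pos (hf z le_rfl).1
  refine le_of_forall_pos_le_add fun η hη => ?_
  set x := min z (β + η / L) with hx
  have hxz : x ≤ z := min_le_left _ _
  have hβx : β < x := lt_min hβz' (lt_add_of_pos_right _ (by positivity))
  have hxL : (x - β) * L ≤ η := by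
    rw [← le_div_iff₀ hLpos]
    have : x ≤ β + η / L := min_le_right _ _
    linarith
  -- Some rule has ratio below `x`, so the threshold rule of `x` has negative value at price `x`.
  -- Used as a competitor at price `β`, its value is below (x - β) L.
  obtain ⟨_, ⟨w, hw, rfl⟩, hwx⟩ := exists_lt_of_csInf_lt (H.ratio_nonempty b) hβx
  rw [div_lt_iff₀ (H.meanLength_pos hw.1)] at hwx
  have h1 := H.optimal_optWait (.of_forall fun y => hne x hxz (y + b)) (hf x hxz) hw
  have h2 := H.optimal_optWait (.of_forall fun y => hne β hβz'.le (y + b)) (hf β hβz'.le)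
    (hf x hxz)
  have h3 : meanLength μ (fun y => optWait μ e x (y + b)) ≤ L :=
    H.meanLength_mono (hf x hxz).1 (hf z le_rfl).1
      fun y => optWait_mono hxz (hne z le_rfl (y + b))
  have h4 := mul_le_mul_of_nonneg_left h3 (sub_nonneg.2 hβx.le)
  linarith

/-- If the least ratio is not below the idle error, then the rule provided by `hW` attains it; the
two cases are therefore exhaustive. -/
theorem isRoot_rootValue {b : ℕ}
    (hW : ∃ w, Feasible μ e b w ∧ ((meanCost μ e b w / meanLength μ w : ℝ) : EReal) ≤
      liminf (fun n : ℕ =>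
        (((1 / (n : ℝ)) * ∑ k ∈ Finset.range n, e k : ℝ) : EReal)) atTop) :
    IsRoot μ e b (rootValue μ e b) := by
  rcases lt_or_ge ((rootValue μ e b : ℝ) : EReal) (liminf (fun n : ℕ =>
      (((1 / (n : ℝ)) * ∑ k ∈ Finset.range n, e k : ℝ) : EReal)) atTop) with h | h
  · exact H.isRoot_of_lt_liminf h
  · obtain ⟨w, hw, hle⟩ := hW
    exact H.isRoot_of_attained hw (by exact_mod_cast hle.trans h)

end IsServiceLaw

end Root

/-! ### Discounted cycles with discount factor tending to one. -/

section Discounted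

variable {μ : Measure ℕ} [IsProbabilityMeasure μ] {e : ℕ → ℝ} {M : ℝ}

/-- Geometric weights preserve a common lower bound of the partial sums. -/
theorem neg_le_sum_pow_mul {r C : ℝ} (hr0 : 0 ≤ r) (hr1 : r ≤ 1) (c : ℕ → ℝ)
    (h : ∀ n, -C ≤ ∑ k ∈ Finset.range n, c k) (N : ℕ) :
    -C ≤ ∑ k ∈ Finset.range N, r ^ k * c k := by
  -- Abel summation in inductive form: the bracket is nonnegative, so its weight may drop from r^N
  -- to r^(N+1).
  have key : r ^ N * (∑ k ∈ Finset.range N, c k + C) ≤ ∑ k ∈ Finset.range N, r ^ k * c k + C := by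
    induction N with
    | zero => simp
    | succ N ih =>
      have h1 : 0 ≤ ∑ k ∈ Finset.range (N + 1), c k + C := by linarith [h (N + 1)]
      have h2 : r ^ (N + 1) ≤ r ^ N := pow_le_pow_of_le_one hr0 hr1 (Nat.le_succ N)
      calc r ^ (N + 1) * (∑ k ∈ Finset.range (N + 1), c k + C)
          ≤ r ^ N * (∑ k ∈ Finset.range (N + 1), c k + C) := mul_le_mul_of_nonneg_right h2 h1
        _ = r ^ N * (∑ k ∈ Finset.range N, c k + C) + r ^ N * c N := by
          rw [Finset.sum_range_succ]; ring
        _ ≤ ∑ k ∈ Finset.range N, r ^ k * c k + C + r ^ N * c N := by linarith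
        _ = _ := by rw [Finset.sum_range_succ]; ring
  have : 0 ≤ r ^ N * (∑ k ∈ Finset.range N, c k + C) :=
    mul_nonneg (pow_nonneg hr0 N) (by linarith [h N])
  linarith

/-- The discounted error in excess of `x`, accumulated over `N` slots from age `δ` on. -/
def discExcess (e : ℕ → ℝ) (x r : ℝ) (δ N : ℕ) : ℝ :=
  ∑ k ∈ Finset.range N, r ^ k * (e (δ + k) - x)

/-- After `ε` is subtracted from each increment the partial sums remain bounded below, and
decreasing weights preserve that bound. Only the geometric sum depends on `r`, which gives
uniformity. -/
theorem le_discExcess_of_drift {x r ε C : ℝ} (hr0 : 0 ≤ r) (hr1 : r ≤ 1) (hε : 0 ≤ ε)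
    (hd : ∀ n : ℕ, ε * n - C ≤ ∑ k ∈ Finset.range n, (e k - x)) (δ N : ℕ) :
    ε * ∑ k ∈ Finset.range N, r ^ k - (C + ∑ k ∈ Finset.range δ, |e k - x|)
      ≤ discExcess e x r δ N := by
  have h := neg_le_sum_pow_mul (C := C + ∑ k ∈ Finset.range δ, |e k - x|) hr0 hr1
    (fun k => e (δ + k) - x - ε) (fun n => by
      have := le_excess_of_drift hε hd δ n
      rw [excess] at this
      rw [Finset.sum_sub_distrib]
      simp only [Finset.sum_const, Finset.card_range, nsmul_eq_mul]
      linarith) N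
  simp only [mul_sub _ _ ε, Finset.sum_sub_distrib] at h
  rw [← Finset.sum_mul] at h
  rw [discExcess]
  linarith

theorem abs_discExcess_le {x r : ℝ} (hr0 : 0 ≤ r) (hr1 : r ≤ 1) {δ N K : ℕ} (h : δ + N ≤ K) :
    |discExcess e x r δ N| ≤ ∑ k ∈ Finset.range K, |e k - x| := by
  refine (Finset.abs_sum_le_sum_abs _ _).trans ?_
  refine le_trans (Finset.sum_le_sum fun k _ => ?_)
    (sum_abs_shift_le (fun k => e k - x) h)
  rw [abs_mul, abs_of_nonneg (pow_nonneg hr0 k)]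
  exact mul_le_of_le_one_left (abs_nonneg _) (pow_le_one₀ hr0 hr1)

theorem tendsto_discExcess {x : ℝ} {r : ℕ → ℝ} (hr : Tendsto r atTop (nhds 1)) (δ N : ℕ) :
    Tendsto (fun n => discExcess e x (r n) δ N) atTop (nhds (excess e x δ N)) := by
  refine tendsto_finsetSum _ fun k _ => ?_
  simpa using (hr.pow k).mul_const (e (δ + k) - x)

namespace IsServiceLaw

variable (H : IsServiceLaw μ e M)
include H

theorem integrable_discExcess (x : ℝ) {r : ℝ} (hr0 : 0 ≤ r) (hr1 : r ≤ 1) (δ w : ℕ) :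
    Integrable (fun y : ℕ => discExcess e x r δ (w + y)) μ :=
  (H.integrable_sum_abs_sub x (δ + w)).mono' (by fun_prop)
    (.of_forall fun y => abs_discExcess_le hr0 hr1 (by omega))

theorem tendsto_integral_discExcess (x : ℝ) {r : ℕ → ℝ} (hr0 : ∀ n, 0 ≤ r n) (hr1 : ∀ n, r n ≤ 1)
    (hr : Tendsto r atTop (nhds 1)) (δ w : ℕ) :
    Tendsto (fun n => ∫ y, discExcess e x (r n) δ (w + y) ∂μ) atTop
      (nhds (meanExcess μ e x δ w)) :=
  tendsto_integral_of_dominated_convergence _ (fun n => by fun_prop)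
    (H.integrable_sum_abs_sub x (δ + w))
    (fun n => .of_forall fun y => abs_discExcess_le (hr0 n) (hr1 n) (by omega))
    (.of_forall fun y => tendsto_discExcess hr δ (w + y))

/-- Uniformity in `w` comes from a split at `K`: shorter waits are finitely many and converge
separately, while longer waits are expensive by the drift, since r^K > 1/2 keeps at least K/2
discounted slots. -/
theorem eventually_le_integral_discExcess {x : ℝ} (hx : HasDrift e x) {r : ℕ → ℝ}
    (hr0 : ∀ n, 0 ≤ r n) (hr1 : ∀ n, r n ≤ 1) (hr : Tendsto r atTop (nhds 1)) (δ : ℕ)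
    {η : ℝ} (hη : 0 < η) :
    ∀ᶠ n in atTop, ∀ w, meanExcess μ e x δ (optWait μ e x δ) - η
      ≤ ∫ y, discExcess e x (r n) δ (w + y) ∂μ := by
  have hmin := H.meanExcess_optWait_le (H.nonempty_of_drift hx δ)
  obtain ⟨ε, hε, C, -, hd⟩ := hx
  set V := meanExcess μ e x δ (optWait μ e x δ)
  set Q := C + ∑ k ∈ Finset.range δ, |e k - x| with hQ
  obtain ⟨K, hK⟩ := exists_nat_gt ((V + Q) / (ε / 2))
  rw [div_lt_iff₀ (by positivity)] at hK
  have hfin : ∀ᶠ n in atTop, ∀ w ∈ Finset.range K,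
      V - η ≤ ∫ y, discExcess e x (r n) δ (w + y) ∂μ := by
    rw [Filter.eventually_all_finset]
    intro w _
    exact ((H.tendsto_integral_discExcess x hr0 hr1 hr δ w).eventually
      (lt_mem_nhds (show V - η < _ by linarith [hmin w]))).mono fun _ h => h.le
  have hpow : ∀ᶠ n in atTop, 1 / 2 < r n ^ K := by
    have := hr.pow K
    rw [one_pow] at this
    exact this.eventually (lt_mem_nhds (by norm_num))
  filter_upwards [hfin, hpow] with n h1 h2 w
  rcases lt_or_ge w K with hw | hw
  · exact h1 w (Finset.mem_range.2 hw)
  · refine le_trans (b := ∫ _, (ε * (K * (1 / 2)) - Q) ∂μ) ?_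
      (integral_mono (integrable_const _)
      (H.integrable_discExcess x (hr0 n) (hr1 n) δ w) fun y => ?_)
    · simp only [integral_const, probReal_univ, smul_eq_mul, one_mul]
      linarith
    · refine le_trans ?_ (le_discExcess_of_drift (hr0 n) (hr1 n) hε.le hd δ (w + y))
      have h3 : (K : ℝ) * (1 / 2) ≤ ∑ k ∈ Finset.range (w + y), r n ^ k := by
        calc (K : ℝ) * (1 / 2) = ∑ k ∈ Finset.range K, (1 / 2 : ℝ) := by simp
          _ ≤ ∑ k ∈ Finset.range K, r n ^ k := Finset.sum_le_sum fun k hk =>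
            h2.le.trans (pow_le_pow_of_le_one (hr0 n) (hr1 n) (Finset.mem_range.1 hk).le)
          _ ≤ _ := Finset.sum_le_sum_of_subset_of_nonneg (Finset.range_mono (by omega))
            fun _ _ _ => pow_nonneg (hr0 n) _
      have := mul_le_mul_of_nonneg_left h3 hε.le
      linarith

/-- If the threshold rule has a positive mean excess error, then the discounted mean excess error
of every waiting rule is nonnegative as soon as the discount factor is close to one. -/
theorem eventually_discounted_nonneg {b : ℕ} {x : ℝ} (hx : HasDrift e x)
    (hf : Feasible μ e b (fun y => optWait μ e x (y + b)))
    (hpos : 0 < ∫ y, meanExcess μ e x (y + b) (optWait μ e x (y + b)) ∂μ) {r : ℕ → ℝ}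
    (hr0 : ∀ n, 0 ≤ r n) (hr1 : ∀ n, r n ≤ 1) (hr : Tendsto r atTop (nhds 1)) :
    ∀ᶠ n in atTop, ∀ w : ℕ → ℕ, 0 ≤ ∫ p : ℕ × ℕ,
      r n ^ p.1 * discExcess e x (r n) (p.1 + b) (w p.1 + p.2) ∂(μ.prod μ) := by
  obtain ⟨ε, hε, C, hC, hd⟩ := id hx
  set V : ℕ → ℝ := fun y => meanExcess μ e x (y + b) (optWait μ e x (y + b)) with hV
  set Q : ℕ → ℝ := fun y => C + ∑ k ∈ Finset.range (y + b), |e k - x| with hQ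
  have hQ0 : ∀ y, 0 ≤ Q y := fun y =>
    add_nonneg hC (Finset.sum_nonneg fun _ _ => abs_nonneg _)
  have hVint : Integrable V μ := H.integrable_meanExcess hf x
  have hQint : Integrable Q μ := (integrable_const C).add (H.integrable_sum_abs_sub x b)
  have hlow : ∀ n y w, -Q y ≤ ∫ y', discExcess e x (r n) (y + b) (w + y') ∂μ := fun n y w => by
    calc -Q y = ∫ _, -Q y ∂μ := by simp
      _ ≤ _ := integral_mono (integrable_const _)
        (H.integrable_discExcess x (hr0 n) (hr1 n) (y + b) w) fun y' => ?_
    refine le_trans ?_ (le_discExcess_of_drift (hr0 n) (hr1 n) hε.le hd (y + b) (w + y'))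
    have : 0 ≤ ε * ∑ k ∈ Finset.range (w + y'), r n ^ k :=
      mul_nonneg hε.le (Finset.sum_nonneg fun k _ => pow_nonneg (hr0 n) k)
    simp only [hQ]
    linarith
  have hbdd : ∀ n y, BddBelow (Set.range fun w =>
      ∫ y', discExcess e x (r n) (y + b) (w + y') ∂μ) := fun n y =>
    ⟨-Q y, by rintro _ ⟨w, rfl⟩; exact hlow n y w⟩
  -- The infimum over waits makes the bound uniform over all rules. Capping it at `V` gives an
  -- integrable dominating function and does not affect the limit, which is `V`.
  set g : ℕ → ℕ → ℝ := fun n y =>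
    min (⨅ w, ∫ y', discExcess e x (r n) (y + b) (w + y') ∂μ) (V y) with hg
  have hgV : ∀ y, Tendsto (fun n => g n y) atTop (nhds (V y)) := fun y => by
    refine tendsto_order.2 ⟨fun a ha => ?_, fun a ha => .of_forall fun n =>
      lt_of_le_of_lt (min_le_right _ _) ha⟩
    filter_upwards [H.eventually_le_integral_discExcess hx hr0 hr1 hr (y + b)
      (half_pos (sub_pos.2 ha))] with n hn
    refine lt_min (lt_of_lt_of_le ?_ (le_ciInf hn)) ha
    simp only [hV] at ha ⊢
    linarith
  have hgabs : ∀ n y, |g n y| ≤ Q y + |V y| := fun n y => by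
    have h1 : g n y ≤ V y := min_le_right _ _
    have h2 : -(Q y + |V y|) ≤ g n y :=
      le_min (by linarith [le_ciInf (hlow n y), abs_nonneg (V y)])
        (by linarith [neg_abs_le (V y), hQ0 y])
    exact abs_le.2 ⟨h2, by linarith [le_abs_self (V y), hQ0 y]⟩
  have hlim : Tendsto (fun n => ∫ y, r n ^ y * g n y ∂μ) atTop (nhds (∫ y, V y ∂μ)) := by
    refine tendsto_integral_of_dominated_convergence (fun y => Q y + |V y|) (fun n => by fun_prop)
      (hQint.add hVint.abs) (fun n => .of_forall fun y => ?_) (.of_forall fun y => ?_)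
    · rw [norm_mul, Real.norm_of_nonneg (pow_nonneg (hr0 n) y)]
      exact (mul_le_of_le_one_left (norm_nonneg _) (pow_le_one₀ (hr0 n) (hr1 n))).trans (hgabs n y)
    · simpa using (hr.pow y).mul (hgV y)
  filter_upwards [hlim.eventually (lt_mem_nhds hpos)] with n hn w
  by_cases hint : Integrable (fun p : ℕ × ℕ =>
      r n ^ p.1 * discExcess e x (r n) (p.1 + b) (w p.1 + p.2)) (μ.prod μ)
  · rw [integral_prod _ hint]
    refine hn.le.trans (integral_mono ?_ hint.integral_prod_left fun y => ?_)
    · refine (hQint.add hVint.abs).mono' (by fun_prop) (.of_forall fun y => ?_)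
      rw [norm_mul, Real.norm_of_nonneg (pow_nonneg (hr0 n) y)]
      exact (mul_le_of_le_one_left (norm_nonneg _) (pow_le_one₀ (hr0 n) (hr1 n))).trans (hgabs n y)
    · dsimp only
      rw [integral_const_mul]
      exact mul_le_mul_of_nonneg_left ((min_le_left _ _).trans (ciInf_le (hbdd n y) (w y)))
        (pow_nonneg (hr0 n) y)
  -- For a rule without integrable discounted excess the Bochner integral is zero by convention.
  · rw [integral_undef hint]

end IsServiceLaw

end Discounted

/-! ### Sample paths: delivery times and the error within a cycle. -/

section Paths

variable {Ω : Type*} {B : ℕ} (T : ℕ → ℕ → Ω → ℕ) (π : Policy B) (ω : Ω)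

theorem sendTime_succ (i : ℕ) :
    sendTime T π ω (i + 1) = deliveryTime T π ω i + π.wait (history T π ω i) := rfl

theorem deliveryTime_succ (i : ℕ) : deliveryTime T π ω (i + 1) = deliveryTime T π ω i +
    (π.wait (history T π ω i) + T (i + 1) (featLen T π ω (i + 1)) ω) := by
  rw [deliveryTime, sendTime_succ, add_assoc]

variable {T π ω} (hpos : ∀ i, 1 ≤ T i (featLen T π ω i) ω)
include hpos

theorem deliveryTime_strictMono : StrictMono (deliveryTime T π ω) :=
  strictMono_nat_of_lt_succ fun i => by
    have := hpos (i + 1)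
    rw [deliveryTime_succ]
    omega

theorem lt_deliveryTime (i : ℕ) : i < deliveryTime T π ω i := by
  induction i with
  | zero => exact (hpos 0).trans (Nat.le_add_left _ _)
  | succ i ih => exact lt_of_le_of_lt ih (deliveryTime_strictMono hpos (Nat.lt_succ_self i))

theorem sendTime_lt_succ (i : ℕ) : sendTime T π ω i < sendTime T π ω (i + 1) := by
  have := hpos i
  rw [sendTime_succ, deliveryTime]
  omega

theorem lastDelivered_eq {i t : ℕ} (h1 : deliveryTime T π ω i ≤ t)
    (h2 : t < deliveryTime T π ω (i + 1)) : lastDelivered T π ω t = i := by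
  rw [lastDelivered, Nat.findGreatest_eq_iff]
  refine ⟨(lt_deliveryTime hpos i).le.trans h1, fun _ => h1, fun n hn _ h => ?_⟩
  exact absurd ((deliveryTime_strictMono hpos).lt_iff_lt.1 (h.trans_lt h2)) (by omega)

theorem slot_error (err : ℕ → ℕ → ℝ) (Δ₀ d₀ : ℕ) {i k : ℕ}
    (hk : k < π.wait (history T π ω i) + T (i + 1) (featLen T π ω (i + 1)) ω) :
    err (aoi T π ω Δ₀ (deliveryTime T π ω i + k)) (currentLen T π ω d₀ (deliveryTime T π ω i + k))
      = err (T i (featLen T π ω i) ω + featPos T π ω i + k) (featLen T π ω i) := by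
  have h0 : ¬ deliveryTime T π ω i + k < deliveryTime T π ω 0 := by
    have := (deliveryTime_strictMono hpos).monotone (Nat.zero_le i)
    omega
  have h1 : lastDelivered T π ω (deliveryTime T π ω i + k) = i :=
    lastDelivered_eq hpos (by omega) (by rw [deliveryTime_succ]; omega)
  rw [aoi, currentLen, if_neg h0, if_neg h0, h1]
  congr 1
  rw [deliveryTime]
  omega

/-- The weight r^(D_i) splits into r^(S_i), which is determined before feature i is sent, and
r^(T_i), which belongs to the pair of transmission times that governs the cycle. -/
theorem sum_cycle (err : ℕ → ℕ → ℝ) (Δ₀ d₀ : ℕ) (x r : ℝ) (i : ℕ) :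
    ∑ t ∈ Finset.Ico (deliveryTime T π ω i) (deliveryTime T π ω (i + 1)),
      r ^ t * (err (aoi T π ω Δ₀ t) (currentLen T π ω d₀ t) - x)
    = r ^ sendTime T π ω i * (r ^ T i (featLen T π ω i) ω *
      discExcess (fun k => err k (featLen T π ω i)) x r
        (T i (featLen T π ω i) ω + featPos T π ω i)
        (π.wait (history T π ω i) + T (i + 1) (featLen T π ω (i + 1)) ω)) := by
  rw [Finset.sum_Ico_eq_sum_range, deliveryTime_succ, Nat.add_sub_cancel_left, ← mul_assoc,
    ← pow_add, discExcess, Finset.mul_sum]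
  refine Finset.sum_congr rfl fun k hk => ?_
  rw [slot_error hpos err Δ₀ d₀ (Finset.mem_range.1 hk), pow_add, deliveryTime, mul_assoc]

omit hpos in
theorem sum_initial (err : ℕ → ℕ → ℝ) (Δ₀ d₀ : ℕ) (x r : ℝ) :
    ∑ t ∈ Finset.range (deliveryTime T π ω 0),
      r ^ t * (err (aoi T π ω Δ₀ t) (currentLen T π ω d₀ t) - x)
    = discExcess (fun k => err k d₀) x r Δ₀ (T 0 1 ω) := by
  have h : deliveryTime T π ω 0 = T 0 1 ω := Nat.zero_add _
  refine Finset.sum_congr (congrArg _ h) fun k hk => ?_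
  rw [aoi, currentLen, if_pos (by rw [h]; exact Finset.mem_range.1 hk),
    if_pos (by rw [h]; exact Finset.mem_range.1 hk)]

end Paths

theorem discExcess_one (e : ℕ → ℝ) (x : ℝ) (δ N : ℕ) : discExcess e x 1 δ N = excess e x δ N := by
  simp [discExcess, excess]

/-! ### Policies of constant length as functions of a fixed sequence of transmission times. -/

section FixedLength

variable {Ω : Type*} {B : ℕ} (T : ℕ → ℕ → Ω → ℕ) (l : ℕ)

/-- The transmission times if the features `1, 2, ...` have length `l`. -/
def fixedTimes (i : ℕ) (ω : Ω) : ℕ := T i (if i = 0 then 1 else l) ω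

/-- The first `i` entries of a sequence, the last one first. -/
def revList (X : ℕ → ℕ) : ℕ → List ℕ
  | 0 => []
  | i + 1 => X i :: revList X i

theorem revList_congr {X X' : ℕ → ℕ} {i : ℕ} (h : ∀ j < i, X j = X' j) :
    revList X i = revList X' i := by
  induction i with
  | zero => rfl
  | succ i ih => rw [revList, revList, h i (Nat.lt_succ_self i), ih fun j hj => h j (by omega)]

/-- The submission time of the next feature as a function of the history. -/
def nextSend (π : Policy B) : List ℕ → ℕ
  | [] => 0
  | y :: h => nextSend π h + y + π.wait (y :: h)

variable {T l} {π : Policy B} (hπ : ∀ h, π.len h = l) (ω : Ω)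
include hπ

theorem featLen_fixed (i : ℕ) : featLen T π ω i = if i = 0 then 1 else l := by
  cases i with
  | zero => rfl
  | succ i => exact hπ _

theorem history_fixed (i : ℕ) :
    history T π ω i = revList (fun j => fixedTimes T l j ω) (i + 1) := by
  induction i with
  | zero => rfl
  | succ i ih => rw [history, hπ, ih]; rfl

theorem time_fixed (i : ℕ) : T i (featLen T π ω i) ω = fixedTimes T l i ω := by
  rw [featLen_fixed hπ]; rfl

theorem sendTime_fixed (i : ℕ) :
    sendTime T π ω i = nextSend π (revList (fun j => fixedTimes T l j ω) i) := by
  induction i with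
  | zero => rfl
  | succ i ih =>
    rw [sendTime_succ, deliveryTime, time_fixed (T := T) hπ, history_fixed hπ, ih, revList, nextSend]

theorem featPos_fixed (i : ℕ) :
    featPos T π ω (i + 1) = π.pos (revList (fun j => fixedTimes T l j ω) (i + 1)) := by
  rw [featPos, history_fixed hπ]

end FixedLength

/-! ### Independence of the past from the next two transmission times. -/

section Law

variable {Ω : Type*} [MeasurableSpace Ω] {P : Measure Ω} {X : ℕ → Ω → ℕ}

/-- A function of the first `i` variables is measurable. -/
theorem measurable_revList (hX : ∀ i, Measurable (X i)) {β : Type*} [MeasurableSpace β]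
    (g : List ℕ → β) (i : ℕ) : Measurable fun ω => g (revList (fun j => X j ω) i) := by
  -- `φ` rebuilds the list from a finite tuple; the default 0 is never read, because only indices
  -- below `i` occur.
  let φ : (Finset.range i → ℕ) → List ℕ := fun z =>
    revList (fun j => if h : j ∈ Finset.range i then z ⟨j, h⟩ else 0) i
  have h : (fun ω => g (revList (fun j => X j ω) i)) =
      (fun z => g (φ z)) ∘ fun ω (j : Finset.range i) => X j ω := by
    funext ω
    simp only [Function.comp, φ]
    congr 1
    exact revList_congr fun j hj => by simp [hj]
  rw [h]
  exact Measurable.of_discrete.comp (measurable_pi_lambda _ fun j => hX j)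

variable [IsProbabilityMeasure P] (hX : ∀ i, Measurable (X i)) (hind : iIndepFun X P)
include hX hind

omit [IsProbabilityMeasure P] in
/-- The first `i` variables are independent of the next two. -/
theorem indepFun_past (i : ℕ) :
    IndepFun (fun ω (j : Finset.range i) => X j ω) (fun ω => (X i ω, X (i + 1) ω)) P := by
  have h := hind.indepFun_finset (Finset.range i) {i, i + 1} (by
    rw [Finset.disjoint_left]
    intro a ha
    simp at ha ⊢
    omega) hX
  exact h.comp (φ := id) (ψ := fun z : ({i, i + 1} : Finset ℕ) → ℕ =>
    (z ⟨i, by simp⟩, z ⟨i + 1, by simp⟩)) measurable_id Measurable.of_discrete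

theorem map_pair {μ : Measure ℕ} (i : ℕ) (h1 : P.map (X i) = μ) (h2 : P.map (X (i + 1)) = μ) :
    P.map (fun ω => (X i ω, X (i + 1) ω)) = μ.prod μ := by
  have := (indepFun_iff_map_prod_eq_prod_map_map (hX i).aemeasurable
    (hX (i + 1)).aemeasurable).1 (hind.indepFun (Nat.ne_of_lt (Nat.lt_succ_self i)))
  rw [this, h1, h2]

/-- A random variable whose conditional mean given the past is nonnegative. -/
theorem integral_past_nonneg {μ : Measure ℕ} [IsProbabilityMeasure μ] (i : ℕ)
    (h1 : P.map (X i) = μ) (h2 : P.map (X (i + 1)) = μ) (F : List ℕ → ℕ × ℕ → ℝ)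
    (hF : ∀ h, 0 ≤ ∫ p, F h p ∂(μ.prod μ)) :
    0 ≤ ∫ ω, F (revList (fun j => X j ω) i) (X i ω, X (i + 1) ω) ∂P := by
  let φ : (Finset.range i → ℕ) → List ℕ := fun z =>
    revList (fun j => if h : j ∈ Finset.range i then z ⟨j, h⟩ else 0) i
  let Z : Ω → (Finset.range i → ℕ) := fun ω j => X j ω
  have hZ : Measurable Z := measurable_pi_lambda _ fun j => hX j
  have hY : Measurable fun ω => (X i ω, X (i + 1) ω) := (hX i).prodMk (hX (i + 1))
  have hmap : P.map (fun ω => (Z ω, (X i ω, X (i + 1) ω))) = (P.map Z).prod (μ.prod μ) := by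
    rw [(indepFun_iff_map_prod_eq_prod_map_map hZ.aemeasurable hY.aemeasurable).1
      (indepFun_past hX hind i), map_pair hX hind i h1 h2]
  have : IsProbabilityMeasure (P.map Z) := Measure.isProbabilityMeasure_map hZ.aemeasurable
  have h : ∀ ω, F (revList (fun j => X j ω) i) (X i ω, X (i + 1) ω) =
      (fun q : (Finset.range i → ℕ) × (ℕ × ℕ) => F (φ q.1) q.2) (Z ω, (X i ω, X (i + 1) ω)) := by
    intro ω
    simp only [φ, Z]
    congr 1
    exact revList_congr fun j hj => by simp [hj]
  simp_rw [h]
  rw [← integral_map (f := fun q : (Finset.range i → ℕ) × (ℕ × ℕ) => F (φ q.1) q.2)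
    (hZ.prodMk hY).aemeasurable Measurable.of_discrete.aestronglyMeasurable, hmap]
  by_cases hint : Integrable (fun q : (Finset.range i → ℕ) × (ℕ × ℕ) => F (φ q.1) q.2)
      ((P.map Z).prod (μ.prod μ))
  · rw [integral_prod _ hint]
    exact integral_nonneg fun z => hF (φ z)
  · rw [integral_undef hint]

omit [IsProbabilityMeasure P] in
theorem indepFun_past_comp (i : ℕ) (g : List ℕ → ℝ) (f : ℕ × ℕ → ℝ) :
    IndepFun (fun ω => g (revList (fun j => X j ω) i)) (fun ω => f (X i ω, X (i + 1) ω)) P := by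
  let φ : (Finset.range i → ℕ) → List ℕ := fun z =>
    revList (fun j => if h : j ∈ Finset.range i then z ⟨j, h⟩ else 0) i
  have h : (fun ω => g (revList (fun j => X j ω) i)) =
      (fun z => g (φ z)) ∘ fun ω (j : Finset.range i) => X j ω := by
    funext ω
    simp only [Function.comp, φ]
    congr 1
    exact revList_congr fun j hj => by simp [hj]
  rw [h]
  exact (indepFun_past hX hind i).comp Measurable.of_discrete Measurable.of_discrete

end Law

/-! ### The model assumptions, with measurability and integrability of the slot errors. -/

/-- The standing assumptions on transmission times and errors. -/
structure IsModel {Ω : Type*} [MeasurableSpace Ω] (P : Measure Ω) (B : ℕ) (err : ℕ → ℕ → ℝ)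
    (T : ℕ → ℕ → Ω → ℕ) (M : ℝ) : Prop where
  meas : ∀ i l, 1 ≤ l → l ≤ B → Measurable (T i l)
  pos : ∀ i l ω, 1 ≤ l → l ≤ B → 1 ≤ T i l ω
  indep : ∀ len : ℕ → ℕ, (∀ i, 1 ≤ len i ∧ len i ≤ B) → iIndepFun (fun i ω => T i (len i) ω) P
  ident : ∀ i l, 1 ≤ l → l ≤ B → IdentDistrib (T i l) (T 0 l) P P
  mean : ∀ i l, 1 ≤ l → l ≤ B → Integrable (fun ω => (T i l ω : ℝ)) P
  lower : ∀ δ d, 1 ≤ d → d ≤ B → M ≤ err δ d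
  cost : ∀ l l' d m, 1 ≤ l → l ≤ B → 1 ≤ l' → l' ≤ B → 1 ≤ d → d ≤ B →
    Integrable (fun ω => ∑ k ∈ Finset.range (T 0 l ω + T 1 l' ω + m), |err k d|) P

theorem measurable_eval {Ω β : Type*} [MeasurableSpace Ω] [MeasurableSpace β] {N : Ω → ℕ}
    (hN : Measurable N) {F : ℕ → Ω → β} (hF : ∀ n, Measurable (F n)) :
    Measurable fun ω => F (N ω) ω :=
  (measurable_from_prod_countable_left (f := fun q : Ω × ℕ => F q.2 q.1) hF).comp
    (measurable_id.prodMk hN)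

section Error

variable {Ω : Type*} {B : ℕ}

/-- The inference error at time `t`. -/
def slotError (err : ℕ → ℕ → ℝ) (T : ℕ → ℕ → Ω → ℕ) (π : Policy B) (Δ₀ d₀ t : ℕ) (ω : Ω) : ℝ :=
  err (aoi T π ω Δ₀ t) (currentLen T π ω d₀ t)

theorem featLen_mem (hB : 1 ≤ B) (T : ℕ → ℕ → Ω → ℕ) (π : Policy B) (ω : Ω) (i : ℕ) :
    1 ≤ featLen T π ω i ∧ featLen T π ω i ≤ B := by
  cases i with
  | zero => exact ⟨le_rfl, hB⟩
  | succ i =>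
    have h := π.admissible (history T π ω i)
    exact ⟨h.1, le_trans (Nat.le_add_left _ _) h.2⟩

theorem featPos_le (T : ℕ → ℕ → Ω → ℕ) (π : Policy B) (ω : Ω) (i : ℕ) : featPos T π ω i ≤ B := by
  cases i with
  | zero => exact Nat.zero_le _
  | succ i => exact le_trans (Nat.le_add_right _ _) (π.admissible (history T π ω i)).2

theorem currentLen_mem (hB : 1 ≤ B) {d₀ : ℕ} (hd₀ : 1 ≤ d₀ ∧ d₀ ≤ B) (T : ℕ → ℕ → Ω → ℕ)
    (π : Policy B) (ω : Ω) (t : ℕ) :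
    1 ≤ currentLen T π ω d₀ t ∧ currentLen T π ω d₀ t ≤ B := by
  rw [currentLen]
  split_ifs
  · exact hd₀
  · exact featLen_mem hB T π ω _

theorem aoi_le (T : ℕ → ℕ → Ω → ℕ) (π : Policy B) (ω : Ω) (Δ₀ t : ℕ) :
    aoi T π ω Δ₀ t ≤ Δ₀ + t + B := by
  rw [aoi]
  split_ifs
  · omega
  · have := featPos_le T π ω (lastDelivered T π ω t)
    omega

/-- At a fixed time the age and the length take finitely many values, so a deterministic bound
exists even if `err` is unbounded. -/
theorem abs_slotError_le (hB : 1 ≤ B) {d₀ : ℕ} (hd₀ : 1 ≤ d₀ ∧ d₀ ≤ B) (err : ℕ → ℕ → ℝ)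
    (T : ℕ → ℕ → Ω → ℕ) (π : Policy B) (Δ₀ t : ℕ) (ω : Ω) :
    |slotError err T π Δ₀ d₀ t ω| ≤
      ∑ k ∈ Finset.range (Δ₀ + t + B + 1), ∑ d ∈ Finset.range (B + 1), |err k d| := by
  have h1 := aoi_le T π ω Δ₀ t
  have h2 := (currentLen_mem hB hd₀ T π ω t).2
  refine le_trans ?_ (Finset.single_le_sum
    (f := fun k => ∑ d ∈ Finset.range (B + 1), |err k d|)
    (fun _ _ => Finset.sum_nonneg fun _ _ => abs_nonneg _)
    (Finset.mem_range.2 (Nat.lt_succ_of_le h1)))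
  exact Finset.single_le_sum (f := fun d => |err (aoi T π ω Δ₀ t) d|) (fun _ _ => abs_nonneg _)
    (Finset.mem_range.2 (Nat.lt_succ_of_le h2))

end Error

namespace IsModel

variable {Ω : Type*} [MeasurableSpace Ω] {P : Measure Ω} [IsProbabilityMeasure P] {B : ℕ}
  {err : ℕ → ℕ → ℝ} {T : ℕ → ℕ → Ω → ℕ} {M : ℝ} (H : IsModel P B err T M)
include H

theorem isProbabilityMeasure_law {l : ℕ} (hl : 1 ≤ l) (hlB : l ≤ B) :
    IsProbabilityMeasure (P.map (T 0 l)) :=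
  Measure.isProbabilityMeasure_map (H.meas 0 l hl hlB).aemeasurable

omit [IsProbabilityMeasure P] in
theorem map_time {l : ℕ} (hl : 1 ≤ l) (hlB : l ≤ B) (i : ℕ) :
    P.map (T i l) = P.map (T 0 l) := (H.ident i l hl hlB).map_eq

theorem map_times {l : ℕ} (hl : 1 ≤ l) (hlB : l ≤ B) (i : ℕ) :
    P.map (fun ω => (T i l ω, T (i + 1) l ω)) = (P.map (T 0 l)).prod (P.map (T 0 l)) :=
  map_pair (X := fun i => T i l) (fun i => H.meas i l hl hlB)
    (H.indep (fun _ => l) fun _ => ⟨hl, hlB⟩) i (H.map_time hl hlB i) (H.map_time hl hlB (i + 1))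

theorem integrable_times_iff {l : ℕ} (hl : 1 ≤ l) (hlB : l ≤ B) (i : ℕ) (f : ℕ × ℕ → ℝ) :
    Integrable (fun ω => f (T i l ω, T (i + 1) l ω)) P ↔
      Integrable f ((P.map (T 0 l)).prod (P.map (T 0 l))) := by
  rw [← H.map_times hl hlB i, integrable_map_measure Measurable.of_discrete.aestronglyMeasurable
    ((H.meas i l hl hlB).prodMk (H.meas (i + 1) l hl hlB)).aemeasurable]
  rfl

theorem integral_times {l : ℕ} (hl : 1 ≤ l) (hlB : l ≤ B) (i : ℕ) (f : ℕ × ℕ → ℝ) :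
    ∫ ω, f (T i l ω, T (i + 1) l ω) ∂P = ∫ p, f p ∂((P.map (T 0 l)).prod (P.map (T 0 l))) := by
  rw [← H.map_times hl hlB i, integral_map
    ((H.meas i l hl hlB).prodMk (H.meas (i + 1) l hl hlB)).aemeasurable
    Measurable.of_discrete.aestronglyMeasurable]

omit [IsProbabilityMeasure P] in
theorem ae_time_iff {l : ℕ} (hl : 1 ≤ l) (hlB : l ≤ B) (i : ℕ) (p : ℕ → Prop) :
    (∀ᵐ ω ∂P, p (T i l ω)) ↔ ∀ᵐ y ∂(P.map (T 0 l)), p y := by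
  rw [← H.map_time hl hlB i, ae_map_iff (H.meas i l hl hlB).aemeasurable
    (Set.to_countable _).measurableSet]

theorem isServiceLaw {l d : ℕ} (hl : 1 ≤ l) (hlB : l ≤ B) (hd : 1 ≤ d) (hdB : d ≤ B) :
    IsServiceLaw (P.map (T 0 l)) (fun k => err k d) M where
  pos := (H.ae_time_iff hl hlB 0 _).1 (.of_forall fun ω => H.pos 0 l ω hl hlB)
  mean := (integrable_map_measure Measurable.of_discrete.aestronglyMeasurable
    (H.meas 0 l hl hlB).aemeasurable).2 (H.mean 0 l hl hlB)
  lower := fun k => H.lower k d hd hdB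
  cost := fun m => (H.integrable_times_iff hl hlB 0
    (fun p => ∑ k ∈ Finset.range (p.1 + p.2 + m), |err k d|)).1 (H.cost l l d m hl hlB hl hlB hd hdB)

omit [IsProbabilityMeasure P] in
theorem gittins_eq {l : ℕ} (hl : 1 ≤ l) (hlB : l ≤ B) (δ : ℕ) :
    gittins P err T l δ l = lawIndex (P.map (T 0 l)) (fun k => err k l) δ := by
  rw [gittins, lawIndex]
  congr 1
  funext τ
  congr 1
  refine Finset.sum_congr rfl fun j _ => ?_
  rw [← H.map_time hl hlB 1, integral_map (H.meas 1 l hl hlB).aemeasurable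
    Measurable.of_discrete.aestronglyMeasurable]

section FixedPolicy

variable {l : ℕ} (hl : 1 ≤ l) (hlB : l ≤ B)
include hl hlB

omit [IsProbabilityMeasure P] in
theorem measurable_fixedTimes (i : ℕ) : Measurable (fixedTimes T l i) := by
  cases i with
  | zero => exact H.meas 0 1 le_rfl (hl.trans hlB)
  | succ i => exact H.meas (i + 1) l hl hlB

omit [IsProbabilityMeasure P] in
theorem iIndepFun_fixedTimes : iIndepFun (fixedTimes T l) P :=
  H.indep (fun i => if i = 0 then 1 else l) fun i => by split_ifs <;> omega

omit [IsProbabilityMeasure P] in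
theorem one_le_time (π : Policy B) (ω : Ω) (i : ℕ) : 1 ≤ T i (featLen T π ω i) ω :=
  have h := featLen_mem (hl.trans hlB) T π ω i
  H.pos i _ ω h.1 h.2

variable {π : Policy B} (hπ : ∀ h, π.len h = l)
include hπ

omit [IsProbabilityMeasure P] in
theorem measurable_sendTime (i : ℕ) : Measurable fun ω => sendTime T π ω i := by
  simp_rw [sendTime_fixed hπ]
  exact measurable_revList (H.measurable_fixedTimes hl hlB) (nextSend π) i

omit [IsProbabilityMeasure P] in
theorem measurable_deliveryTime (i : ℕ) : Measurable fun ω => deliveryTime T π ω i := by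
  simp_rw [deliveryTime, time_fixed hπ]
  exact (H.measurable_sendTime hl hlB hπ i).add (H.measurable_fixedTimes hl hlB i)

omit [IsProbabilityMeasure P] in
theorem measurable_featPos (i : ℕ) : Measurable fun ω => featPos T π ω i := by
  cases i with
  | zero => exact measurable_const
  | succ i =>
    simp_rw [featPos_fixed hπ]
    exact measurable_revList (H.measurable_fixedTimes hl hlB) π.pos (i + 1)

omit [IsProbabilityMeasure P] in
theorem measurable_slotError (Δ₀ d₀ t : ℕ) : Measurable (slotError err T π Δ₀ d₀ t) := by
  have hD := H.measurable_deliveryTime hl hlB hπ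
  have hlast : Measurable fun ω => lastDelivered T π ω t :=
    measurable_findGreatest fun k _ => measurableSet_le (hD k) measurable_const
  have h0 : MeasurableSet {ω | t < deliveryTime T π ω 0} := measurableSet_lt measurable_const (hD 0)
  have h1 : Measurable fun ω => aoi T π ω Δ₀ t := by
    refine Measurable.ite h0 measurable_const (Measurable.add ?_ ?_)
    · exact measurable_const.sub (measurable_eval hlast (H.measurable_sendTime hl hlB hπ))
    · exact measurable_eval hlast (H.measurable_featPos hl hlB hπ)
  have h2 : Measurable fun ω => currentLen T π ω d₀ t := by
    refine Measurable.ite h0 measurable_const ?_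
    refine measurable_eval (F := fun i ω => featLen T π ω i) hlast fun i => ?_
    simp_rw [featLen_fixed hπ]
    exact measurable_const
  exact (Measurable.of_discrete (f := fun q : ℕ × ℕ => err q.1 q.2)).comp (h1.prodMk h2)

theorem integrable_slotError {d₀ : ℕ} (hd₀ : 1 ≤ d₀ ∧ d₀ ≤ B) (Δ₀ t : ℕ) :
    Integrable (slotError err T π Δ₀ d₀ t) P :=
  (integrable_const _).mono' (H.measurable_slotError hl hlB hπ Δ₀ d₀ t).aestronglyMeasurable
    (.of_forall fun ω => abs_slotError_le (hl.trans hlB) hd₀ err T π Δ₀ t ω)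

omit [IsProbabilityMeasure P] hπ in
theorem le_slotError {d₀ : ℕ} (hd₀ : 1 ≤ d₀ ∧ d₀ ≤ B) (Δ₀ t : ℕ) (ω : Ω) :
    M ≤ slotError err T π Δ₀ d₀ t ω :=
  have h := currentLen_mem (hl.trans hlB) hd₀ T π ω t
  H.lower _ _ h.1 h.2

theorem avgError_eq {d₀ : ℕ} (hd₀ : 1 ≤ d₀ ∧ d₀ ≤ B) (Δ₀ : ℕ) : avgError P err T Δ₀ d₀ π =
    limsup (fun n : ℕ => (((1 / (n : ℝ)) *
      ∑ t ∈ Finset.range n, ∫ ω, slotError err T π Δ₀ d₀ t ω ∂P : ℝ) : EReal)) atTop := by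
  rw [avgError]
  congr 1
  funext n
  rw [← integral_finsetSum _ fun t _ => H.integrable_slotError hl hlB hπ hd₀ Δ₀ t]
  rfl

end FixedPolicy

end IsModel

/-! ### Sums with a random number of terms. -/

section RandomSum

variable {Ω : Type*} [MeasurableSpace Ω] {P : Measure Ω} {f : ℕ → Ω → ℝ}

/-- The full series of norms has finite expectation and dominates every partial sum, wherever it is
stopped. -/
theorem integrable_sum_range_random (hmeas : ∀ t, Measurable (f t))
    (hint : ∀ t, Integrable (f t) P) (hsum : Summable fun t => ∫ ω, ‖f t ω‖ ∂P) {N : Ω → ℕ}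
    (hN : Measurable N) : Integrable (fun ω => ∑ t ∈ Finset.range (N ω), f t ω) P := by
  refine ⟨(measurable_eval (F := fun n ω => ∑ t ∈ Finset.range n, f t ω) hN
    fun n => Finset.measurable_fun_sum _ fun t _ => hmeas t).aestronglyMeasurable, ?_⟩
  have h1 : ∫⁻ ω, ∑' t, ‖f t ω‖ₑ ∂P < ⊤ := by
    rw [lintegral_tsum fun t => (hmeas t).enorm.aemeasurable]
    have h2 : ∀ t, ∫⁻ ω, ‖f t ω‖ₑ ∂P = ENNReal.ofReal (∫ ω, ‖f t ω‖ ∂P) := fun t => by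
      rw [ofReal_integral_norm_eq_lintegral_enorm (hint t)]
    simp_rw [h2]
    rw [← ENNReal.ofReal_tsum_of_nonneg (fun t => integral_nonneg fun _ => norm_nonneg _) hsum]
    exact ENNReal.ofReal_lt_top
  refine lt_of_le_of_lt (lintegral_mono fun ω => ?_) h1
  exact (enorm_sum_le _ _).trans (ENNReal.sum_le_tsum _)

/-- The mean of a random number `N` of terms tends to the sum of the means. -/
theorem tendsto_integral_sum_range_random (hint : ∀ t, Integrable (f t) P) (hsum : Summable fun t => ∫ ω, ‖f t ω‖ ∂P) {N : ℕ → Ω → ℕ}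
    (hN : ∀ n, Measurable (N n)) (hle : ∀ n ω, n ≤ N n ω) :
    Tendsto (fun n => ∫ ω, ∑ t ∈ Finset.range (N n ω), f t ω ∂P) atTop
      (nhds (∑' t, ∫ ω, f t ω ∂P)) := by
  have hset : ∀ n t, MeasurableSet {ω | t < N n ω} := fun n t =>
    measurableSet_lt measurable_const (hN n)
  have hnorm : ∀ n t ω, ‖({ω | t < N n ω}.indicator (f t)) ω‖ ≤ ‖f t ω‖ := fun n t ω =>
    norm_indicator_le_norm_self _ _
  have hint' : ∀ n t, Integrable ({ω | t < N n ω}.indicator (f t)) P := fun n t =>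
    (hint t).indicator (hset n t)
  have hle' : ∀ n t, ∫ ω, ‖({ω | t < N n ω}.indicator (f t)) ω‖ ∂P ≤ ∫ ω, ‖f t ω‖ ∂P :=
    fun n t => integral_mono (hint' n t).norm (hint t).norm fun ω => hnorm n t ω
  have h1 : ∀ n, ∫ ω, ∑ t ∈ Finset.range (N n ω), f t ω ∂P =
      ∑' t, ∫ ω, ({ω | t < N n ω}.indicator (f t)) ω ∂P := fun n => by
    rw [integral_tsum_of_summable_integral_norm (hint' n)
      (hsum.of_nonneg_of_le (fun t => integral_nonneg fun _ => norm_nonneg _) (hle' n))]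
    refine integral_congr_ae (.of_forall fun ω => ?_)
    dsimp only
    rw [tsum_eq_sum (s := Finset.range (N n ω)) fun t ht => ?_]
    · refine Finset.sum_congr rfl fun t ht => ?_
      rw [Set.indicator_of_mem]
      exact Finset.mem_range.1 ht
    · rw [Set.indicator_of_notMem]
      simpa using ht
  simp_rw [h1]
  refine tendsto_tsum_of_dominated_convergence hsum (fun t => ?_) (.of_forall fun n t =>
    (norm_integral_le_integral_norm _).trans (hle' n t))
  refine tendsto_const_nhds.congr' ?_
  filter_upwards [eventually_gt_atTop t] with n hn
  refine integral_congr_ae (.of_forall fun ω => ?_)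
  rw [Set.indicator_of_mem]
  exact hn.trans_le (hle n ω)

end RandomSum

/-! ### The lower bound for every policy of constant feature length. -/

theorem sum_range_delivery_succ {Ω : Type*} {B : ℕ} {T : ℕ → ℕ → Ω → ℕ} {π : Policy B} {ω : Ω}
    (hpos : ∀ i, 1 ≤ T i (featLen T π ω i) ω) (f : ℕ → ℝ) (i : ℕ) :
    ∑ t ∈ Finset.range (deliveryTime T π ω (i + 1)), f t =
      ∑ t ∈ Finset.range (deliveryTime T π ω i), f t +
      ∑ t ∈ Finset.Ico (deliveryTime T π ω i) (deliveryTime T π ω (i + 1)), f t := by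
  rw [Finset.range_eq_Ico, Finset.range_eq_Ico, Finset.sum_Ico_consecutive _ (Nat.zero_le _)
    (deliveryTime_strictMono hpos (Nat.lt_succ_self i)).le]

/-- If the partial sums of `a - z` are bounded above, then so are the discounted sums of `a - x`,
up to a term of order `(x - z) / (1 - r)`. -/
theorem tsum_discounted_le {a : ℕ → ℝ} {z x C r : ℝ} (hC : ∀ n, ∑ t ∈ Finset.range n, (a t - z) ≤ C)
    (hr0 : 0 ≤ r) (hr1 : r < 1) (hs : Summable fun t => r ^ t * (a t - x)) :
    ∑' t, r ^ t * (a t - x) ≤ C - (x - z) * (1 - r)⁻¹ := by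
  refine le_of_tendsto_of_tendsto' hs.hasSum.tendsto_sum_nat (tendsto_const_nhds.sub
    ((hasSum_geometric_of_lt_one hr0 hr1).tendsto_sum_nat.const_mul (x - z))) fun n => ?_
  have h := neg_le_sum_pow_mul (C := C) hr0 hr1.le (fun t => -(a t - z)) (fun n => by
    rw [Finset.sum_neg_distrib]
    exact neg_le_neg (hC n)) n
  have h2 : ∑ t ∈ Finset.range n, r ^ t * (a t - x) =
      -∑ t ∈ Finset.range n, r ^ t * -(a t - z) - (x - z) * ∑ t ∈ Finset.range n, r ^ t := by
    rw [Finset.mul_sum, ← Finset.sum_neg_distrib, ← Finset.sum_sub_distrib]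
    exact Finset.sum_congr rfl fun t _ => by ring
  rw [h2]
  linarith

namespace IsModel

variable {Ω : Type*} [MeasurableSpace Ω] {P : Measure Ω} [IsProbabilityMeasure P] {B : ℕ}
  {err : ℕ → ℕ → ℝ} {T : ℕ → ℕ → Ω → ℕ} {M : ℝ} (H : IsModel P B err T M)
  {l : ℕ} (hl : 1 ≤ l) (hlB : l ≤ B) {π : Policy B} (hπ : ∀ h, π.len h = l)
  {d₀ : ℕ} (hd₀ : 1 ≤ d₀ ∧ d₀ ≤ B)
include H hl hlB hπ hd₀

/-- If every waiting rule has a nonnegative discounted mean excess error per cycle, then the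
discounted excess error of the policy is bounded below. -/
theorem neg_le_tsum_discounted (Δ₀ : ℕ) {x r ε C : ℝ} (hr0 : 0 ≤ r) (hr1 : r ≤ 1) (hε : 0 ≤ ε)
    (hd : ∀ n : ℕ, ε * n - C ≤ ∑ k ∈ Finset.range n, (err k 1 - x))
    (hcyc : ∀ b, b + l ≤ B → ∀ w : ℕ → ℕ, 0 ≤ ∫ p : ℕ × ℕ,
      r ^ p.1 * discExcess (fun k => err k l) x r (p.1 + b) (w p.1 + p.2)
        ∂((P.map (T 0 l)).prod (P.map (T 0 l))))
    (hsum : Summable fun t => ∫ ω, ‖r ^ t * (slotError err T π Δ₀ d₀ t ω - x)‖ ∂P) :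
    -∫ y, (∑ k ∈ Finset.range (y + Δ₀), |err k d₀ - x| +
        (C + ∑ k ∈ Finset.range y, |err k 1 - x|)) ∂(P.map (T 0 1))
      ≤ ∑' t, ∫ ω, r ^ t * (slotError err T π Δ₀ d₀ t ω - x) ∂P := by
  have hB := hl.trans hlB
  have := H.isProbabilityMeasure_law hl hlB
  have := H.isProbabilityMeasure_law le_rfl hB
  set f : ℕ → Ω → ℝ := fun t ω => r ^ t * (slotError err T π Δ₀ d₀ t ω - x) with hf
  have hmeas : ∀ t, Measurable (f t) := fun t =>
    ((H.measurable_slotError hl hlB hπ Δ₀ d₀ t).sub_const x).const_mul _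
  have hint : ∀ t, Integrable (f t) P := fun t =>
    ((H.integrable_slotError hl hlB hπ hd₀ Δ₀ t).sub (integrable_const x)).const_mul _
  have hD := H.measurable_deliveryTime hl hlB hπ
  have hpos : ∀ ω i, 1 ≤ T i (featLen T π ω i) ω := H.one_le_time hl hlB π
  have hint' : ∀ n, Integrable (fun ω => ∑ t ∈ Finset.range (deliveryTime T π ω n), f t ω) P :=
    fun n => integrable_sum_range_random hmeas hint hsum (hD n)
  have hT0 := H.meas 0 1 le_rfl hB
  set Z : ℕ → ℝ := fun y => ∑ k ∈ Finset.range (y + Δ₀), |err k d₀ - x| +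
        (C + ∑ k ∈ Finset.range y, |err k 1 - x|) with hZ
  have hZint : Integrable Z (P.map (T 0 1)) := by
    refine ((H.isServiceLaw le_rfl hB hd₀.1 hd₀.2).integrable_sum_abs_sub x Δ₀).add
      ((integrable_const C).add ?_)
    simpa using (H.isServiceLaw le_rfl hB le_rfl hB).integrable_sum_abs_sub x 0
  -- The induction starts at the delivery of feature 1: the stretch before the first delivery and
  -- the cycle of feature 0, whose length is 1 whatever `l` is, are bounded through `Z` and the
  -- drift of `err k 1`. All later cycles are covered by `hcyc`.
  have key : ∀ n, -∫ y, Z y ∂(P.map (T 0 1)) ≤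
      ∫ ω, ∑ t ∈ Finset.range (deliveryTime T π ω (n + 1)), f t ω ∂P := fun n => by
    induction n with
    | zero =>
      have hZint' : Integrable (fun ω => Z (T 0 1 ω)) P := hZint.comp_measurable hT0
      rw [integral_map hT0.aemeasurable Measurable.of_discrete.aestronglyMeasurable,
        ← integral_neg]
      refine integral_mono hZint'.neg (hint' 1) fun ω => ?_
      dsimp only
      rw [sum_range_delivery_succ (hpos ω)]
      simp only [hf, slotError]
      rw [sum_initial, sum_cycle (hpos ω)]
      have h1 := neg_le_of_abs_le (abs_discExcess_le (e := fun k => err k d₀) (x := x) hr0 hr1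
        (show Δ₀ + T 0 1 ω ≤ T 0 1 ω + Δ₀ by omega))
      have h2 := le_discExcess_of_drift hr0 hr1 hε hd (T 0 1 ω)
        (π.wait (history T π ω 0) + T (0 + 1) (featLen T π ω (0 + 1)) ω)
      have h3 : 0 ≤ ε * ∑ k ∈ Finset.range
          (π.wait (history T π ω 0) + T (0 + 1) (featLen T π ω (0 + 1)) ω), r ^ k :=
        mul_nonneg hε (Finset.sum_nonneg fun k _ => pow_nonneg hr0 k)
      have hC : 0 ≤ C := by simpa using hd 0
      have hQ : 0 ≤ C + ∑ k ∈ Finset.range (T 0 1 ω), |err k 1 - x| :=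
        add_nonneg hC (Finset.sum_nonneg fun _ _ => abs_nonneg _)
      have hr1' : r ^ T 0 1 ω ≤ 1 := pow_le_one₀ hr0 hr1
      have hr0' : 0 ≤ r ^ T 0 1 ω := pow_nonneg hr0 _
      have h4 : -(C + ∑ k ∈ Finset.range (T 0 1 ω), |err k 1 - x|) ≤ r ^ T 0 1 ω *
          discExcess (fun k => err k 1) x r (T 0 1 ω)
            (π.wait (history T π ω 0) + T (0 + 1) (featLen T π ω (0 + 1)) ω) := by
        have := mul_le_mul_of_nonneg_left
          (show -(C + ∑ k ∈ Finset.range (T 0 1 ω), |err k 1 - x|) ≤ _ by linarith) hr0'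
        nlinarith
      simp only [sendTime, pow_zero, one_mul, featLen, featPos, add_zero, hZ] at h4 ⊢
      linarith
    | succ n ih =>
      have hsplit : ∀ ω, ∑ t ∈ Finset.Ico (deliveryTime T π ω (n + 1))
          (deliveryTime T π ω (n + 1 + 1)), f t ω =
          ∑ t ∈ Finset.range (deliveryTime T π ω (n + 1 + 1)), f t ω -
          ∑ t ∈ Finset.range (deliveryTime T π ω (n + 1)), f t ω := fun ω => by
        rw [sum_range_delivery_succ (hpos ω) (fun t => f t ω) (n + 1)]; ring
      have hcycle : 0 ≤ ∫ ω, ∑ t ∈ Finset.Ico (deliveryTime T π ω (n + 1))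
          (deliveryTime T π ω (n + 1 + 1)), f t ω ∂P := by
        have h := integral_past_nonneg (H.measurable_fixedTimes hl hlB)
          (H.iIndepFun_fixedTimes hl hlB) (n + 1) (H.map_time hl hlB (n + 1))
          (H.map_time hl hlB (n + 1 + 1)) (fun h p => r ^ nextSend π h *
            (r ^ p.1 * discExcess (fun k => err k l) x r (p.1 + π.pos h)
              (π.wait (p.1 :: h) + p.2))) fun h => by
            rw [integral_const_mul]
            refine mul_nonneg (pow_nonneg hr0 _) ?_
            have hadm := (π.admissible h).2
            rw [hπ] at hadm
            exact hcyc _ hadm fun y => π.wait (y :: h)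
        refine h.trans_eq (integral_congr_ae (.of_forall fun ω => ?_))
        simp only [hf, slotError]
        rw [sum_cycle (hpos ω), time_fixed (T := T) hπ, time_fixed (T := T) hπ,
          sendTime_fixed hπ, featPos_fixed hπ, history_fixed hπ]
        rw [featLen, hπ]
        rfl
      simp_rw [hsplit] at hcycle
      rw [integral_sub (hint' _) (hint' _)] at hcycle
      linarith
  refine ge_of_tendsto (tendsto_integral_sum_range_random hint hsum
    (N := fun n ω => deliveryTime T π ω (n + 1)) (fun n => hD (n + 1)) fun n ω => ?_)
    (.of_forall key)
  exact (Nat.le_succ n).trans (lt_deliveryTime (hpos ω) (n + 1)).le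

/-- A lower bound for the average error of a policy with constant feature length. -/
theorem le_avgError (Δ₀ : ℕ) {x : ℝ} (h1 : HasDrift (fun k => err k 1) x)
    (hx : HasDrift (fun k => err k l) x)
    (hb : ∀ b, b + l ≤ B → x < rootValue (P.map (T 0 l)) (fun k => err k l) b) :
    (x : EReal) ≤ avgError P err T Δ₀ d₀ π := by
  have hB := hl.trans hlB
  have := H.isProbabilityMeasure_law hl hlB
  have HS := H.isServiceLaw hl hlB hl hlB
  by_contra! hlt
  rw [H.avgError_eq hl hlB hπ hd₀] at hlt
  obtain ⟨z, hz, hzx⟩ := EReal.lt_iff_exists_real_btwn.1 hlt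
  have hzx' : z < x := by exact_mod_cast hzx
  obtain ⟨ε, hε, C₁, -, hd⟩ := h1
  set a : ℕ → ℝ := fun t => ∫ ω, slotError err T π Δ₀ d₀ t ω ∂P with ha
  have haM : ∀ t, M ≤ a t := fun t => by
    calc M = ∫ _, M ∂P := by simp
      _ ≤ _ := integral_mono (integrable_const _) (H.integrable_slotError hl hlB hπ hd₀ Δ₀ t)
        fun ω => H.le_slotError hl hlB hd₀ Δ₀ t ω
  obtain ⟨C, hC⟩ : ∃ C, ∀ n, ∑ t ∈ Finset.range n, (a t - z) ≤ C := by
    obtain ⟨N, hN⟩ := eventually_atTop.1 (eventually_lt_of_limsup_lt hz)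
    have h0 : ∀ n, 0 ≤ ∑ n ∈ Finset.range n, |∑ t ∈ Finset.range n, (a t - z)| := fun n =>
      Finset.sum_nonneg fun _ _ => abs_nonneg _
    refine ⟨∑ n ∈ Finset.range (N + 1), |∑ t ∈ Finset.range n, (a t - z)|, fun n => ?_⟩
    rcases le_or_gt n N with hn | hn
    · exact (le_abs_self _).trans (Finset.single_le_sum
        (f := fun n => |∑ t ∈ Finset.range n, (a t - z)|) (fun _ _ => abs_nonneg _)
        (Finset.mem_range.2 (Nat.lt_succ_of_le hn)))
    · refine le_trans ?_ (h0 _)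
      have hn0 : (0 : ℝ) < n := by exact_mod_cast (by omega : 0 < n)
      have h2 : 1 / (n : ℝ) * ∑ t ∈ Finset.range n, a t < z := by exact_mod_cast hN n hn.le
      rw [one_div, inv_mul_eq_div, div_lt_iff₀ hn0] at h2
      rw [Finset.sum_sub_distrib]
      simp only [Finset.sum_const, Finset.card_range, nsmul_eq_mul]
      linarith
  -- Partial sums bounded above together with terms bounded below let `a t` grow at most linearly,
  -- so the discounted series converges.
  have hgrow : ∀ t, a t - z ≤ C + t * |M - z| := fun t => by
    have h2 := hC (t + 1)
    rw [Finset.sum_range_succ] at h2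
    have h3 : ∑ s ∈ Finset.range t, -|M - z| ≤ ∑ s ∈ Finset.range t, (a s - z) :=
      Finset.sum_le_sum fun s _ => (neg_abs_le _).trans (sub_le_sub_right (haM s) z)
    simp only [Finset.sum_const, Finset.card_range, nsmul_eq_mul] at h3
    linarith
  have hsum : ∀ r : ℝ, 0 ≤ r → r < 1 →
      Summable fun t => ∫ ω, ‖r ^ t * (slotError err T π Δ₀ d₀ t ω - x)‖ ∂P := fun r hr0 hr1 => by
    have hs : Summable fun t : ℕ => (C + z - M + |M - x|) * r ^ t + |M - z| * (t * r ^ t) := by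
      refine ((summable_geometric_of_lt_one hr0 hr1).mul_left _).add (Summable.mul_left _ ?_)
      simpa using summable_pow_mul_geometric_of_norm_lt_one 1
        (show ‖r‖ < 1 by rwa [Real.norm_of_nonneg hr0])
    refine hs.of_nonneg_of_le (fun t => integral_nonneg fun _ => norm_nonneg _) fun t => ?_
    have hi := H.integrable_slotError hl hlB hπ hd₀ Δ₀ t
    have hle : ∫ ω, ‖r ^ t * (slotError err T π Δ₀ d₀ t ω - x)‖ ∂P ≤
        ∫ ω, r ^ t * (slotError err T π Δ₀ d₀ t ω + (|M - x| - M)) ∂P := by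
      refine integral_mono ((hi.sub (integrable_const x)).const_mul _).norm
        ((hi.add (integrable_const _)).const_mul _) fun ω => ?_
      dsimp only
      rw [norm_mul, Real.norm_of_nonneg (pow_nonneg hr0 t), Real.norm_eq_abs]
      refine mul_le_mul_of_nonneg_left ?_ (pow_nonneg hr0 t)
      have h2 := H.le_slotError hl hlB hd₀ (π := π) Δ₀ t ω
      have h3 := abs_add_le (slotError err T π Δ₀ d₀ t ω - M) (M - x)
      rw [abs_of_nonneg (sub_nonneg.2 h2), sub_add_sub_cancel] at h3
      linarith
    rw [integral_const_mul, integral_add hi (integrable_const _)] at hle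
    simp only [integral_const, probReal_univ, smul_eq_mul, one_mul] at hle
    have h4 : r ^ t * (a t + (|M - x| - M)) ≤ r ^ t * (C + t * |M - z| + z + (|M - x| - M)) :=
      mul_le_mul_of_nonneg_left (by linarith [hgrow t]) (pow_nonneg hr0 t)
    exact (hle.trans h4).trans (le_of_eq (by ring))
  set r : ℕ → ℝ := fun n => 1 - 1 / ((n : ℝ) + 1) with hr
  have hr0 : ∀ n, 0 ≤ r n := fun n => by
    have : 1 / ((n : ℝ) + 1) ≤ 1 := by rw [div_le_one (by positivity)]; linarith [n.cast_nonneg (α := ℝ)]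
    simp only [hr]; linarith
  have hr1 : ∀ n, r n < 1 := fun n => by
    have : 0 < 1 / ((n : ℝ) + 1) := by positivity
    simp only [hr]; linarith
  have hrlim : Tendsto r atTop (nhds 1) := by
    simpa [hr] using (tendsto_const_nhds (x := (1 : ℝ))).sub (tendsto_one_div_add_atTop_nhds_zero_nat (𝕜 := ℝ))
  have hcyc : ∀ᶠ n in atTop, ∀ b ∈ Finset.range (B + 1), b + l ≤ B → ∀ w : ℕ → ℕ, 0 ≤ ∫ p : ℕ × ℕ,
      r n ^ p.1 * discExcess (fun k => err k l) x (r n) (p.1 + b) (w p.1 + p.2)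
        ∂((P.map (T 0 l)).prod (P.map (T 0 l))) := by
    rw [Filter.eventually_all_finset]
    intro b _
    by_cases hbl : b + l ≤ B
    · obtain ⟨hf, hp⟩ := HS.meanExcess_pos_of_lt_rootValue hx (hb b hbl)
      filter_upwards [HS.eventually_discounted_nonneg hx hf hp hr0 (fun n => (hr1 n).le) hrlim]
        with n hn _ using hn
    · exact .of_forall fun n h => absurd h hbl
  set Z := ∫ y, (∑ k ∈ Finset.range (y + Δ₀), |err k d₀ - x| +
        (C₁ + ∑ k ∈ Finset.range y, |err k 1 - x|)) ∂(P.map (T 0 1))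
  -- For r = 1 - 1/(n+1) the bounds give (x - z)(n + 1) ≤ C + Z, which fails for n ≥ K.
  obtain ⟨K, hK⟩ := exists_nat_gt ((C + Z) / (x - z))
  rw [div_lt_iff₀ (sub_pos.2 hzx')] at hK
  obtain ⟨n, hn, hKn⟩ := (hcyc.and (eventually_ge_atTop K)).exists
  have hlow := H.neg_le_tsum_discounted hl hlB hπ hd₀ Δ₀ (hr0 n) (hr1 n).le hε.le hd
    (fun b hbl => hn b (Finset.mem_range.2 (by omega)) hbl) (hsum _ (hr0 n) (hr1 n))
  have hI : ∀ t, ∫ ω, r n ^ t * (slotError err T π Δ₀ d₀ t ω - x) ∂P = r n ^ t * (a t - x) :=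
    fun t => by
    rw [integral_const_mul, integral_sub (H.integrable_slotError hl hlB hπ hd₀ Δ₀ t)
      (integrable_const x)]
    simp [ha]
  have hsumm : Summable fun t => r n ^ t * (a t - x) := by
    simp_rw [← hI]
    exact (hsum _ (hr0 n) (hr1 n)).of_norm_bounded fun t => norm_integral_le_integral_norm _
  simp_rw [hI] at hlow
  have hup := tsum_discounted_le hC (hr0 n) (hr1 n) hsumm
  have hinv : (1 - r n)⁻¹ = (n : ℝ) + 1 := by simp [hr]
  rw [hinv] at hup
  have hKn' : (K : ℝ) ≤ n := by exact_mod_cast hKn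
  nlinarith

end IsModel

/-! ### The upper bound for stationary policies, by a renewal-reward argument. -/

/-- A cycle that meets the slots before `n` has its feature submitted before `n`. Testing the
submission time `S` rather than the delivery time `D` may count an extra cycle, but keeps the
indicator independent of the transmission times in the cycle. -/
theorem sum_range_min_le {D S : ℕ → ℕ} {c : ℕ → ℝ} (hc : ∀ t, 0 ≤ c t) (hD : StrictMono D)
    (hS : ∀ i, S i ≤ D i) (n m : ℕ) :
    ∑ t ∈ Finset.range (min n (D (m + 1))), c t ≤ ∑ t ∈ Finset.range (D 1), c t +
      ∑ j ∈ Finset.range m, (if S (j + 1) < n then 1 else 0) *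
        ∑ t ∈ Finset.Ico (D (j + 1)) (D (j + 1 + 1)), c t := by
  have hsub : ∀ {a b : ℕ}, a ≤ b → ∑ t ∈ Finset.range a, c t ≤ ∑ t ∈ Finset.range b, c t :=
    fun h => Finset.sum_le_sum_of_subset_of_nonneg (Finset.range_mono h) fun _ _ _ => hc _
  induction m with
  | zero => simpa using hsub (min_le_right _ _)
  | succ m ih =>
    rw [Finset.sum_range_succ, ← add_assoc]
    rcases le_or_gt n (D (m + 1)) with h | h
    · have h1 : min n (D (m + 1 + 1)) = min n (D (m + 1)) := by
        have : D (m + 1) < D (m + 1 + 1) := hD (Nat.lt_succ_self (m + 1))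
        omega
      rw [h1]
      refine le_add_of_le_of_nonneg ih (mul_nonneg (by split_ifs <;> norm_num)
        (Finset.sum_nonneg fun _ _ => hc _))
    · rw [min_eq_right h.le] at ih
      rw [if_pos ((hS _).trans_lt h), one_mul]
      refine (hsub (min_le_right _ _)).trans ?_
      have h2 : ∑ t ∈ Finset.range (D (m + 1 + 1)), c t = ∑ t ∈ Finset.range (D (m + 1)), c t +
          ∑ t ∈ Finset.Ico (D (m + 1)) (D (m + 1 + 1)), c t := by
        rw [Finset.range_eq_Ico, Finset.range_eq_Ico, Finset.sum_Ico_consecutive _ (Nat.zero_le _)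
          (hD (Nat.lt_succ_self (m + 1))).le]
      rw [h2]
      linarith

/-- Only the increment that crosses `n` can overshoot. Its part up to `K` is absorbed in `n + K` and
the rest in the positive part, so first moments suffice. -/
theorem sum_increments_le {S Y : ℕ → ℕ} (hS : ∀ j, S (j + 1) = S j + Y j) (n K m : ℕ) :
    ∑ j ∈ Finset.range m, (if S j < n then (1 : ℝ) else 0) * (Y j : ℝ) ≤
      min (S m : ℝ) (n + K) + ∑ j ∈ Finset.range m, max ((Y j : ℝ) - K) 0 := by
  induction m with
  | zero => simp; positivity
  | succ m ih =>
    rw [Finset.sum_range_succ, Finset.sum_range_succ]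
    have h1 : (S (m + 1) : ℝ) = S m + Y m := by exact_mod_cast hS m
    have hY : (0 : ℝ) ≤ Y m := Nat.cast_nonneg _
    have hK : (0 : ℝ) ≤ K := Nat.cast_nonneg _
    have h2 : (0 : ℝ) ≤ max ((Y m : ℝ) - K) 0 := le_max_right _ _
    have h3 : (Y m : ℝ) - K ≤ max ((Y m : ℝ) - K) 0 := le_max_left _ _
    rw [h1]
    split_ifs with h
    · have h4 : (S m : ℝ) ≤ n := by exact_mod_cast h.le
      have h5 : min (S m : ℝ) (n + K) = S m := min_eq_left (by linarith)
      rw [h5] at ih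
      rcases min_cases ((S m : ℝ) + Y m) (n + K) with ⟨h6, _⟩ | ⟨h6, _⟩ <;> rw [h6] <;> linarith
    · have h4 : min (S m : ℝ) (n + K) ≤ min ((S m : ℝ) + Y m) (n + K) :=
        min_le_min_right _ (by linarith)
      linarith

theorem tendsto_integral_max_sub {α : Type*} [MeasurableSpace α] {ν : Measure α} {Y : α → ℝ}
    (hY : Integrable Y ν) (h0 : ∀ a, 0 ≤ Y a) :
    Tendsto (fun K : ℕ => ∫ a, max (Y a - K) 0 ∂ν) atTop (nhds 0) := by
  have h : Tendsto (fun K : ℕ => ∫ a, max (Y a - K) 0 ∂ν) atTop (nhds (∫ _, (0 : ℝ) ∂ν)) := by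
    refine tendsto_integral_of_dominated_convergence Y
      (fun K => (hY.aestronglyMeasurable.sub aestronglyMeasurable_const).sup
        aestronglyMeasurable_const) hY (fun K => .of_forall fun a => ?_)
      (.of_forall fun a => ?_)
    · rw [Real.norm_of_nonneg (le_max_right _ _)]
      exact max_le (sub_le_self _ (Nat.cast_nonneg _)) (h0 a)
    · refine tendsto_const_nhds.congr' ?_
      obtain ⟨N, hN⟩ := exists_nat_ge (Y a)
      filter_upwards [eventually_ge_atTop N] with K hK
      have : (N : ℝ) ≤ K := by exact_mod_cast hK
      rw [max_eq_right (by linarith)]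
  simpa using h

namespace IsModel

variable {Ω : Type*} [MeasurableSpace Ω] {P : Measure Ω} [IsProbabilityMeasure P] {B : ℕ}
  {err : ℕ → ℕ → ℝ} {T : ℕ → ℕ → Ω → ℕ} {M : ℝ} (H : IsModel P B err T M)
  {l : ℕ} (hl : 1 ≤ l) (hlB : l ≤ B) {π : Policy B} (hπ : ∀ h, π.len h = l)
include H hl hlB hπ

/-- The submission time of a feature is independent of the next two transmission times. -/
theorem integral_sent_mul (n j : ℕ) {f : ℕ × ℕ → ℝ}
    (hf : Integrable f ((P.map (T 0 l)).prod (P.map (T 0 l)))) :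
    Integrable (fun ω => (if sendTime T π ω (j + 1) < n then (1 : ℝ) else 0) *
      f (T (j + 1) l ω, T (j + 1 + 1) l ω)) P ∧
    ∫ ω, (if sendTime T π ω (j + 1) < n then (1 : ℝ) else 0) *
      f (T (j + 1) l ω, T (j + 1 + 1) l ω) ∂P =
    (∫ ω, (if sendTime T π ω (j + 1) < n then (1 : ℝ) else 0) ∂P) *
      ∫ p, f p ∂((P.map (T 0 l)).prod (P.map (T 0 l))) := by
  have hχmeas : Measurable fun ω => (if sendTime T π ω (j + 1) < n then (1 : ℝ) else 0) :=
    Measurable.ite (measurableSet_lt (H.measurable_sendTime hl hlB hπ (j + 1))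
      measurable_const) measurable_const measurable_const
  have hχ : Integrable (fun ω => (if sendTime T π ω (j + 1) < n then (1 : ℝ) else 0)) P :=
    (integrable_const (1 : ℝ)).mono' hχmeas.aestronglyMeasurable
      (.of_forall fun ω => by split_ifs <;> simp)
  have hindep : IndepFun (fun ω => (if sendTime T π ω (j + 1) < n then (1 : ℝ) else 0))
      (fun ω => f (T (j + 1) l ω, T (j + 1 + 1) l ω)) P := by
    have h := indepFun_past_comp (H.measurable_fixedTimes hl hlB) (H.iIndepFun_fixedTimes hl hlB)
      (j + 1) (fun h => if nextSend π h < n then (1 : ℝ) else 0) f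
    simp_rw [sendTime_fixed hπ]
    exact h
  have hf' := (H.integrable_times_iff hl hlB (j + 1) f).2 hf
  refine ⟨hindep.integrable_mul hχ hf', ?_⟩
  rw [hindep.integral_fun_mul_eq_mul_integral hχmeas.aestronglyMeasurable
    hf'.aestronglyMeasurable, H.integral_times hl hlB (j + 1)]

/-- The mean number of submissions before time `n`, times the mean length of a cycle. -/
theorem sum_prob_mul_le {w : ℕ → ℕ} (hw : Integrable (fun y => (w y : ℝ)) (P.map (T 0 l)))
    (hwait : ∀ y y' h, π.wait (y :: y' :: h) = w y) (n K : ℕ) :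
    (∑ j ∈ Finset.range n, ∫ ω, (if sendTime T π ω (j + 1) < n then (1 : ℝ) else 0) ∂P) *
        meanLength (P.map (T 0 l)) w
      ≤ n + K + n * ∫ y : ℕ, max ((y : ℝ) + w y - K) 0 ∂(P.map (T 0 l)) := by
  have := H.isProbabilityMeasure_law hl hlB
  have HS := H.isServiceLaw hl hlB hl hlB
  set μ := P.map (T 0 l)
  have hYint : Integrable (fun y : ℕ => (y : ℝ) + w y) μ := HS.mean.add hw
  -- The time between submissions, T_j + w(T_j), has the same mean as the time between deliveries,
  -- w(T_j) + T_{j+1}, because the transmission times are identically distributed.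
  have hL : ∫ p : ℕ × ℕ, ((p.1 : ℝ) + w p.1) ∂(μ.prod μ) = meanLength μ w := by
    rw [meanLength, integral_add (HS.mean.comp_fst μ) (hw.comp_fst μ),
      integral_add (hw.comp_fst μ) (HS.mean.comp_snd μ),
      integral_fun_fst (μ := μ) (ν := μ) (f := fun y : ℕ => (y : ℝ)),
      integral_fun_snd (μ := μ) (ν := μ) (f := fun y : ℕ => (y : ℝ)), add_comm]
  have hstep : ∀ ω j, sendTime T π ω (j + 1 + 1) =
      sendTime T π ω (j + 1) + (T (j + 1) l ω + w (T (j + 1) l ω)) := fun ω j => by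
    rw [sendTime_succ, deliveryTime, history, history_fixed hπ]
    have h1 : featLen T π ω (j + 1) = l := hπ _
    rw [h1, hπ, revList, hwait, add_assoc]
  have hYj : ∀ j, Integrable (fun ω => ((T (j + 1) l ω + w (T (j + 1) l ω) : ℕ) : ℝ)) P := fun j => by
    have := (H.integrable_times_iff hl hlB (j + 1) (fun p => (p.1 : ℝ) + w p.1)).2
      (hYint.comp_fst μ)
    simpa using this
  have hterm := fun j => H.integral_sent_mul hl hlB hπ n j
    (f := fun p => ((p.1 + w p.1 : ℕ) : ℝ)) (by simpa using hYint.comp_fst μ)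
  have hL' : ∫ p : ℕ × ℕ, ((p.1 + w p.1 : ℕ) : ℝ) ∂(μ.prod μ) = meanLength μ w := by
    rw [← hL]; push_cast; rfl
  simp only [μ, hL'] at hterm
  have hρ : ∀ j, ∫ ω, max (((T (j + 1) l ω + w (T (j + 1) l ω) : ℕ) : ℝ) - K) 0 ∂P =
      ∫ y : ℕ, max ((y : ℝ) + w y - K) 0 ∂μ := fun j => by
    rw [show μ = P.map (T (j + 1) l) from (H.map_time hl hlB (j + 1)).symm,
      integral_map (H.meas (j + 1) l hl hlB).aemeasurable
      Measurable.of_discrete.aestronglyMeasurable]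
    push_cast
    rfl
  have hmax : ∀ j, Integrable (fun ω => max (((T (j + 1) l ω + w (T (j + 1) l ω) : ℕ) : ℝ) - K) 0) P :=
    fun j => ((hYj j).sub (integrable_const (K : ℝ))).pos_part
  rw [Finset.sum_mul]
  rw [Finset.sum_congr rfl fun j _ => (hterm j).2.symm]
  rw [← integral_finsetSum _ fun j _ => (hterm j).1]
  calc ∫ ω, ∑ j ∈ Finset.range n, (if sendTime T π ω (j + 1) < n then (1 : ℝ) else 0) *
        ((T (j + 1) l ω + w (T (j + 1) l ω) : ℕ) : ℝ) ∂P
      ≤ ∫ ω, ((n : ℝ) + K + ∑ j ∈ Finset.range n,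
          max (((T (j + 1) l ω + w (T (j + 1) l ω) : ℕ) : ℝ) - K) 0) ∂P := by
        refine integral_mono
          (integrable_finsetSum _ fun j _ => (hterm j).1)
          ((integrable_const _).add (integrable_finsetSum _ fun j _ => hmax j)) fun ω => ?_
        refine (sum_increments_le (S := fun j => sendTime T π ω (j + 1)) (hstep ω) n K n).trans ?_
        gcongr
        exact min_le_right _ _
    _ = _ := by
        rw [integral_add (integrable_const _) (integrable_finsetSum _ fun j _ => hmax j),
          integral_finsetSum _ fun j _ => hmax j]
        simp_rw [hρ]
        simp

/-- An upper bound for the average error of a stationary policy. -/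
theorem avgError_le {d₀ : ℕ} (hd₀ : 1 ≤ d₀ ∧ d₀ ≤ B) (Δ₀ : ℕ) {b : ℕ} {w : ℕ → ℕ}
    (hpos : ∀ h, π.pos h = b) (hwait : ∀ y y' h, π.wait (y :: y' :: h) = w y)
    (hw : Feasible (P.map (T 0 l)) (fun k => err k l) b w)
    (hinit : Integrable (fun ω => ∑ t ∈ Finset.range (deliveryTime T π ω 1),
      (slotError err T π Δ₀ d₀ t ω - M)) P) :
    avgError P err T Δ₀ d₀ π ≤ ((meanCost (P.map (T 0 l)) (fun k => err k l) b w /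
      meanLength (P.map (T 0 l)) w : ℝ) : EReal) := by
  have := H.isProbabilityMeasure_law hl hlB
  have HS := H.isServiceLaw hl hlB hl hlB
  set μ := P.map (T 0 l)
  set J := meanCost μ (fun k => err k l) b w
  set L := meanLength μ w with hLdef
  have hL : 0 < L := HS.meanLength_pos hw.1
  have hR : 0 ≤ J - M * L := sub_nonneg.2 (HS.mul_meanLength_le hw)
  set I₀ := ∫ ω, ∑ t ∈ Finset.range (deliveryTime T π ω 1), (slotError err T π Δ₀ d₀ t ω - M) ∂P
  have hpos' : ∀ ω i, 1 ≤ T i (featLen T π ω i) ω := H.one_le_time hl hlB π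
  have hφ : ∀ ω j, ∑ t ∈ Finset.Ico (deliveryTime T π ω (j + 1)) (deliveryTime T π ω (j + 1 + 1)),
      (slotError err T π Δ₀ d₀ t ω - M) =
      excess (fun k => err k l) M (T (j + 1) l ω + b)
        (w (T (j + 1) l ω) + T (j + 1 + 1) l ω) := fun ω j => by
    have h := sum_cycle (hpos' ω) err Δ₀ d₀ M 1 (j + 1)
    simp only [one_pow, one_mul, discExcess_one] at h
    have h1 : ∀ i, featLen T π ω (i + 1) = l := fun i => hπ _
    rw [h1, h1] at h
    simp only [slotError]
    rw [h, featPos, hpos, history, history_fixed hπ, hπ, revList, hwait]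
  have hterm := fun n j => H.integral_sent_mul hl hlB hπ n j
    (f := fun p => excess (fun k => err k l) M (p.1 + b) (w p.1 + p.2))
    (HS.integrable_excess_of_feasible hw M)
  have hcyc : ∫ p : ℕ × ℕ, excess (fun k => err k l) M (p.1 + b) (w p.1 + p.2) ∂(μ.prod μ) =
    J - M * L := HS.integral_excess hw M
  have hslot : ∀ t, Integrable (fun ω => slotError err T π Δ₀ d₀ t ω - M) P := fun t =>
    (H.integrable_slotError hl hlB hπ hd₀ Δ₀ t).sub (integrable_const M)
  -- Relative to `M` the errors are nonnegative, so unfinished cycles may be completed. By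
  -- independence the mean total is the mean number of cycles begun times the mean excess `J - M *
  -- L` of one cycle.
  have hsum : ∀ n K : ℕ, ∑ t ∈ Finset.range n, ∫ ω, slotError err T π Δ₀ d₀ t ω ∂P ≤
      M * n + I₀ + (n + K + n * ∫ y : ℕ, max ((y : ℝ) + w y - K) 0 ∂μ) / L * (J - M * L) :=
    fun n K => by
    have h1 : ∑ t ∈ Finset.range n, ∫ ω, slotError err T π Δ₀ d₀ t ω ∂P =
        M * n + ∫ ω, ∑ t ∈ Finset.range n, (slotError err T π Δ₀ d₀ t ω - M) ∂P := by
      rw [integral_finsetSum _ fun t _ => hslot t]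
      simp_rw [integral_sub (H.integrable_slotError hl hlB hπ hd₀ Δ₀ _) (integrable_const M)]
      simp [Finset.sum_sub_distrib, mul_comm]
    have h2 : ∫ ω, ∑ t ∈ Finset.range n, (slotError err T π Δ₀ d₀ t ω - M) ∂P ≤
        ∫ ω, (∑ t ∈ Finset.range (deliveryTime T π ω 1), (slotError err T π Δ₀ d₀ t ω - M) +
          ∑ j ∈ Finset.range n, (if sendTime T π ω (j + 1) < n then (1 : ℝ) else 0) *
            excess (fun k => err k l) M (T (j + 1) l ω + b)
              (w (T (j + 1) l ω) + T (j + 1 + 1) l ω)) ∂P := by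
      refine integral_mono (integrable_finsetSum _ fun t _ => hslot t)
        (hinit.add (integrable_finsetSum _ fun j _ => (hterm n j).1)) fun ω => ?_
      have h := sum_range_min_le (D := deliveryTime T π ω) (S := sendTime T π ω)
        (c := fun t => slotError err T π Δ₀ d₀ t ω - M)
        (fun t => sub_nonneg.2 (H.le_slotError hl hlB hd₀ Δ₀ t ω))
        (deliveryTime_strictMono (hpos' ω)) (fun i => Nat.le_add_right _ _) n n
      rw [min_eq_left (by have := lt_deliveryTime (hpos' ω) (n + 1); omega)] at h
      simpa only [hφ] using h
    rw [integral_add hinit (integrable_finsetSum _ fun j _ => (hterm n j).1),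
      integral_finsetSum _ fun j _ => (hterm n j).1] at h2
    simp_rw [fun j => (hterm n j).2] at h2
    rw [← Finset.sum_mul, hcyc] at h2
    have h3 := H.sum_prob_mul_le hl hlB hπ hw.1 hwait n K
    rw [← le_div_iff₀ hL] at h3
    have h4 := mul_le_mul_of_nonneg_right h3 hR
    linarith
  by_contra! hlt
  rw [H.avgError_eq hl hlB hπ hd₀] at hlt
  obtain ⟨z, hz, hzlim⟩ := EReal.lt_iff_exists_real_btwn.1 hlt
  have hz' : J / L < z := by exact_mod_cast hz
  refine absurd hzlim (not_lt.2 (limsup_le_of_le (h := ?_)))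
  set η := z - J / L with hη
  have hη0 : 0 < η := sub_pos.2 hz'
  have hlimρ : Tendsto (fun K : ℕ => (∫ y : ℕ, max ((y : ℝ) + w y - K) 0 ∂μ) * ((J - M * L) / L))
      atTop (nhds 0) := by
    have := (tendsto_integral_max_sub (ν := μ) (Y := fun y : ℕ => (y : ℝ) + w y)
      (HS.mean.add hw.1) fun y => by positivity).mul_const ((J - M * L) / L)
    rwa [zero_mul] at this
  -- The truncation level `K` is fixed before `n` grows: the tail term is then at most half of `η`,
  -- and the terms independent of `n` vanish after division by `n`.
  obtain ⟨K, hK⟩ := (hlimρ.eventually (gt_mem_nhds (half_pos hη0))).exists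
  set ρ := ∫ y : ℕ, max ((y : ℝ) + w y - K) 0 ∂μ
  have hlim2 : Tendsto (fun n : ℕ => (I₀ + K * ((J - M * L) / L)) / (n : ℝ)) atTop (nhds 0) :=
    tendsto_const_div_atTop_nhds_zero_nat _
  filter_upwards [hlim2.eventually (gt_mem_nhds (half_pos hη0)), eventually_gt_atTop 0] with n hn hn0
  have hn0' : (0 : ℝ) < n := by exact_mod_cast hn0
  have h := hsum n K
  have hfin : 1 / (n : ℝ) * ∑ t ∈ Finset.range n, ∫ ω, slotError err T π Δ₀ d₀ t ω ∂P ≤ z := by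
    calc 1 / (n : ℝ) * ∑ t ∈ Finset.range n, ∫ ω, slotError err T π Δ₀ d₀ t ω ∂P
        ≤ 1 / (n : ℝ) * (M * n + I₀ + (n + K + n * ρ) / L * (J - M * L)) :=
          mul_le_mul_of_nonneg_left h (by positivity)
      _ = J / L + (I₀ + K * ((J - M * L) / L)) / (n : ℝ) + ρ * ((J - M * L) / L) := by
          field_simp
          ring
      _ ≤ z := by linarith
  exact_mod_cast hfin

end IsModel

/-! ### The threshold policy and the translation between the model and the cycle problem. -/

/-- The policy that sends features of length `l` from position `b` and waits `w y` slots after a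
transmission time `y`, except for a waiting time `v y` after the initial feature. -/
def stationaryPolicy {B l b : ℕ} (h : Admissible B l b) (w v : ℕ → ℕ) : Policy B where
  wait
    | [] => 0
    | [y] => v y
    | y :: _ :: _ => w y
  pos _ := b
  len _ := l
  admissible _ := h

namespace IsModel

variable {Ω : Type*} [MeasurableSpace Ω] {P : Measure Ω} [IsProbabilityMeasure P] {B : ℕ}
  {err : ℕ → ℕ → ℝ} {T : ℕ → ℕ → Ω → ℕ} {M : ℝ} (H : IsModel P B err T M)
include H

section Root

variable {l : ℕ} (hl : 1 ≤ l) (hlB : l ≤ B)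
include hl hlB

omit [IsProbabilityMeasure P] in
-- At time s + y + w the age is y + b + w, so the first admissible time is the delivery time plus
-- `optWait`.
theorem isLeast_thresholdTimes {x : ℝ} {b s y : ℕ}
    (hne : {w | x ≤ lawIndex (P.map (T 0 l)) (fun k => err k l) (y + b + w)}.Nonempty) :
    IsLeast (thresholdTimes P err T l b x s (s + y))
      (s + y + optWait (P.map (T 0 l)) (fun k => err k l) x (y + b)) := by
  refine ⟨⟨Nat.le_add_right _ _, ?_⟩, fun t ht => ?_⟩
  · rw [H.gittins_eq hl hlB]
    have h : x ≤ lawIndex (P.map (T 0 l)) (fun k => err k l)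
      (y + b + optWait (P.map (T 0 l)) (fun k => err k l) x (y + b)) := Nat.sInf_mem hne
    convert h using 2
    omega
  · obtain ⟨h1, h2⟩ := ht
    obtain ⟨w, rfl⟩ := Nat.exists_eq_add_of_le h1
    rw [H.gittins_eq hl hlB] at h2
    refine Nat.add_le_add_left (optWait_le ?_) _
    convert h2 using 2
    omega

omit [IsProbabilityMeasure P] in
theorem nonempty_thresholdTimes_iff {x : ℝ} {b s y : ℕ} :
    (thresholdTimes P err T l b x s (s + y)).Nonempty ↔
      {w | x ≤ lawIndex (P.map (T 0 l)) (fun k => err k l) (y + b + w)}.Nonempty := by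
  refine ⟨fun ⟨t, h1, h2⟩ => ?_, fun h => ⟨_, (H.isLeast_thresholdTimes hl hlB h).1⟩⟩
  obtain ⟨w, rfl⟩ := Nat.exists_eq_add_of_le h1
  rw [H.gittins_eq hl hlB] at h2
  refine ⟨w, ?_⟩
  rw [Set.mem_ofPred_eq]
  convert h2 using 2
  omega

omit [IsProbabilityMeasure P] in
theorem thresholdDelivery_succ {x : ℝ} {b i : ℕ} {ω : Ω}
    (hne : {w | x ≤ lawIndex (P.map (T 0 l)) (fun k => err k l) (T i l ω + b + w)}.Nonempty) :
    thresholdDelivery P err T l b x ω (i + 1) = thresholdDelivery P err T l b x ω i +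
      (optWait (P.map (T 0 l)) (fun k => err k l) x (T i l ω + b) + T (i + 1) l ω) := by
  rw [thresholdDelivery, thresholdSend, (H.isLeast_thresholdTimes hl hlB hne).csInf_eq,
    thresholdDelivery, add_assoc]

omit [IsProbabilityMeasure P] in
theorem cycleError_eq {x : ℝ} {b i : ℕ} {ω : Ω}
    (hne : {w | x ≤ lawIndex (P.map (T 0 l)) (fun k => err k l) (T i l ω + b + w)}.Nonempty) :
    cycleError P err T l b x i ω = ∑ k ∈ Finset.range
      (optWait (P.map (T 0 l)) (fun k => err k l) x (T i l ω + b) + T (i + 1) l ω),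
      err (T i l ω + b + k) l := by
  rw [cycleError, H.thresholdDelivery_succ hl hlB hne, Finset.sum_Ico_eq_sum_range,
    Nat.add_sub_cancel_left]
  refine Finset.sum_congr rfl fun k _ => ?_
  congr 1
  rw [thresholdDelivery]
  omega

omit [IsProbabilityMeasure P] in
theorem cycleLength_eq {x : ℝ} {b i : ℕ} {ω : Ω}
    (hne : {w | x ≤ lawIndex (P.map (T 0 l)) (fun k => err k l) (T i l ω + b + w)}.Nonempty) :
    cycleLength P err T l b x i ω =
      (optWait (P.map (T 0 l)) (fun k => err k l) x (T i l ω + b) : ℝ) + T (i + 1) l ω := by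
  rw [cycleLength, H.thresholdDelivery_succ hl hlB hne]
  push_cast
  ring

/-- Each consecutive pair of transmission times has the same product law, so the root condition is
the same for all cycles, and cycle 0 alone yields the converse. -/
theorem isRenewalRoot_iff {b : ℕ} {x : ℝ} : IsRenewalRoot P err T l b x ↔
    IsRoot (P.map (T 0 l)) (fun k => err k l) b x := by
  have := H.isProbabilityMeasure_law hl hlB
  have HS := H.isServiceLaw hl hlB hl hlB
  set μ := P.map (T 0 l) with hμ
  set e : ℕ → ℝ := fun k => err k l with he
  set w : ℕ → ℕ := fun y => optWait μ e x (y + b) with hw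
  let fE : ℕ × ℕ → ℝ := fun p => ∑ k ∈ Finset.range (w p.1 + p.2), e (p.1 + b + k)
  let fL : ℕ × ℕ → ℝ := fun p => (w p.1 : ℝ) + (p.2 : ℝ)
  have hne : ∀ i, (∀ᵐ ω ∂P, (thresholdTimes P err T l b x (thresholdSend P err T l b x ω i)
      (thresholdDelivery P err T l b x ω i)).Nonempty) ↔
      ∀ᵐ y ∂μ, {w | x ≤ lawIndex μ e (y + b + w)}.Nonempty := fun i => by
    rw [← H.ae_time_iff hl hlB i]
    simp only [thresholdDelivery, H.nonempty_thresholdTimes_iff hl hlB]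
    rfl
  have hE : ∀ i, (∀ᵐ y ∂μ, {w | x ≤ lawIndex μ e (y + b + w)}.Nonempty) →
      cycleError P err T l b x i =ᵐ[P] fun ω => fE (T i l ω, T (i + 1) l ω) :=
    fun i h => ((H.ae_time_iff hl hlB i _).2 h).mono fun ω hω => H.cycleError_eq hl hlB hω
  have hL : ∀ i, (∀ᵐ y ∂μ, {w | x ≤ lawIndex μ e (y + b + w)}.Nonempty) →
      cycleLength P err T l b x i =ᵐ[P] fun ω => fL (T i l ω, T (i + 1) l ω) :=
    fun i h => ((H.ae_time_iff hl hlB i _).2 h).mono fun ω hω => H.cycleLength_eq hl hlB hω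
  constructor
  · intro h
    obtain ⟨h1, h2, h3, h4⟩ := h 0
    rw [hne] at h1
    rw [integrable_congr (hE 0 h1), H.integrable_times_iff hl hlB 0 fE] at h2
    rw [integrable_congr (hL 0 h1), H.integrable_times_iff hl hlB 0 fL] at h3
    rw [integral_congr_ae (hE 0 h1), integral_congr_ae (hL 0 h1),
        H.integral_times hl hlB 0 fE, H.integral_times hl hlB 0 fL] at h4
    refine ⟨h1, ⟨?_, h2⟩, h4⟩
    have h5 : Integrable (fun p : ℕ × ℕ => (w p.1 : ℝ)) (μ.prod μ) :=
      h3.mono' Measurable.of_discrete.aestronglyMeasurable (.of_forall fun p => by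
        rw [Real.norm_of_nonneg (Nat.cast_nonneg _)]
        exact le_add_of_nonneg_right (Nat.cast_nonneg _))
    exact (measurePreserving_fst (μ := μ) (ν := μ)).integrable_comp
      Measurable.of_discrete.aestronglyMeasurable |>.1 h5
  · rintro ⟨h1, h2, h3⟩ i
    refine ⟨(hne i).2 h1, ?_, ?_, ?_⟩
    · rw [integrable_congr (hE i h1), H.integrable_times_iff hl hlB i fE]
      exact h2.2
    · rw [integrable_congr (hL i h1), H.integrable_times_iff hl hlB i fL]
      exact HS.integrable_length h2.1
    · rw [integral_congr_ae (hE i h1), integral_congr_ae (hL i h1),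
        H.integral_times hl hlB i fE, H.integral_times hl hlB i fL]
      exact h3

theorem exists_feasible_of_worthSending {b : ℕ} (hW : WorthSending P err T l b) :
    ∃ w, Feasible (P.map (T 0 l)) (fun k => err k l) b w ∧
      ((meanCost (P.map (T 0 l)) (fun k => err k l) b w / meanLength (P.map (T 0 l)) w : ℝ) : EReal)
        ≤ liminf (fun n : ℕ =>
          (((1 / (n : ℝ)) * ∑ k ∈ Finset.range n, err k l : ℝ) : EReal)) atTop := by
  obtain ⟨w, h1, h2, h3⟩ := hW
  refine ⟨w, ⟨?_, ?_⟩, ?_⟩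
  · exact (integrable_map_measure Measurable.of_discrete.aestronglyMeasurable
      (H.meas 0 l hl hlB).aemeasurable).2 h1
  · exact (H.integrable_times_iff hl hlB 0
      (fun p => ∑ k ∈ Finset.range (w p.1 + p.2), err (p.1 + b + k) l)).1 h2
  · rw [meanCost, meanLength, ← H.integral_times hl hlB 0, ← H.integral_times hl hlB 0]
    exact h3

end Root

/-- The threshold policy of a root has an average error not above the root. -/
theorem exists_threshold_policy {l b : ℕ} (hadm : Admissible B l b) {x : ℝ}
    (hx : IsRoot (P.map (T 0 l)) (fun k => err k l) b x)
    {d₀ : ℕ} (hd₀ : 1 ≤ d₀ ∧ d₀ ≤ B) (Δ₀ : ℕ) :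
    ∃ π ∈ timeInvariantPolicies B, avgError P err T Δ₀ d₀ π ≤ (x : EReal) ∧
      (∀ ω i, featLen T π ω (i + 1) = l ∧ featPos T π ω (i + 1) = b) ∧
      ∀ᵐ ω ∂P, ∀ i, featLen T π ω i = l → featPos T π ω i = b →
        IsLeast {t : ℕ | sendTime T π ω i + T i l ω ≤ t ∧
          x ≤ gittins P err T l (t - sendTime T π ω i + b) l} (sendTime T π ω (i + 1)) := by
  classical
  have hl : 1 ≤ l := hadm.1
  have hlB : l ≤ B := (Nat.le_add_left l b).trans hadm.2
  have hB := hl.trans hlB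
  have := H.isProbabilityMeasure_law hl hlB
  have := H.isProbabilityMeasure_law le_rfl hB
  have HS := H.isServiceLaw hl hlB hl hlB
  set w : ℕ → ℕ := fun y => optWait (P.map (T 0 l)) (fun k => err k l) x (y + b) with hw
  set v : ℕ → ℕ := fun y => if l = 1 ∧ b = 0 then w y else 0 with hv
  set π : Policy B := stationaryPolicy hadm w v
  have hlen : ∀ h, π.len h = l := fun _ => rfl
  have hpos : ∀ ω i, 1 ≤ T i (featLen T π ω i) ω := H.one_le_time hl hlB π
  refine ⟨π, ⟨l, hl, hlB, hlen⟩, ?_, fun ω i => ⟨rfl, rfl⟩, ?_⟩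
  · have hroot : meanCost (P.map (T 0 l)) (fun k => err k l) b w / meanLength (P.map (T 0 l)) w = x := by
      rw [div_eq_iff (HS.meanLength_pos hx.2.1.1).ne']
      exact sub_eq_zero.1 hx.2.2
    rw [← hroot]
    refine H.avgError_le hl hlB hlen hd₀ Δ₀ (fun _ => rfl) (fun _ _ _ => rfl) hx.2.1 ?_
    have h0 : ∀ ω, ∑ t ∈ Finset.range (deliveryTime T π ω 1), (slotError err T π Δ₀ d₀ t ω - M) =
        excess (fun k => err k d₀) M Δ₀ (0 + T 0 1 ω) +
        excess (fun k => err k 1) M (T 0 1 ω + 0) (v (T 0 1 ω) + T 1 l ω) := fun ω => by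
      rw [sum_range_delivery_succ (hpos ω)]
      have h1 := sum_initial (T := T) (π := π) (ω := ω) err Δ₀ d₀ M 1
      have h2 := sum_cycle (hpos ω) err Δ₀ d₀ M 1 0
      simp only [one_pow, one_mul, discExcess_one] at h1 h2
      simp only [slotError]
      rw [h1, h2, zero_add (T 0 1 ω)]
      rfl
    simp_rw [h0]
    refine Integrable.add ?_ ?_
    · exact ((H.isServiceLaw le_rfl hB hd₀.1 hd₀.2).integrable_excess M Δ₀ 0).comp_measurable
        (H.meas 0 1 le_rfl hB)
    · by_cases hlb : l = 1 ∧ b = 0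
      · have hvw : v = w := funext fun y => if_pos hlb
        obtain ⟨rfl, rfl⟩ := hlb
        rw [hvw]
        exact (H.integrable_times_iff hl hlB 0 (fun p => excess (fun k => err k 1) M (p.1 + 0)
          (w p.1 + p.2))).2 (HS.integrable_excess_of_feasible hx.2.1 M)
      · have hv0 : v = fun _ => 0 := funext fun y => if_neg hlb
        rw [hv0]
        refine ((H.cost 1 l 1 0 le_rfl hB hl hlB le_rfl hB).add
          ((H.mean 1 l hl hlB).const_mul |M|)).mono' ?_ (.of_forall fun ω => ?_)
        · exact ((Measurable.of_discrete (f := fun p : ℕ × ℕ =>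
            excess (fun k => err k 1) M (p.1 + 0) (0 + p.2))).comp
            ((H.meas 0 1 le_rfl hB).prodMk (H.meas 1 l hl hlB))).aestronglyMeasurable
        · rw [zero_add, add_zero]
          exact abs_excess_le _ M le_rfl
  · have hne : ∀ᵐ ω ∂P, ∀ i, {w | x ≤ lawIndex (P.map (T 0 l)) (fun k => err k l)
        (T i l ω + b + w)}.Nonempty :=
      ae_all_iff.2 fun i => (H.ae_time_iff hl hlB i _).2 hx.1
    filter_upwards [hne] with ω hω i hi1 hi2
    have hwait : π.wait (history T π ω i) = w (T i l ω) := by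
      cases i with
      | zero =>
        have hlb : l = 1 ∧ b = 0 := ⟨hi1.symm, hi2.symm⟩
        have h1 : T 0 1 ω = T 0 l ω := by rw [hlb.1]
        exact (if_pos hlb).trans (congrArg w h1)
      | succ i => rw [history, history_fixed hlen, hlen, revList]; rfl
    rw [sendTime_succ, deliveryTime, hi1, hwait]
    exact H.isLeast_thresholdTimes hl hlB (hω i)

end IsModel

end RemoteInference

/-! ### Assembly of the roots, the two bounds and the optimal policy. -/

theorem theorem1 {Ω : Type*} [MeasurableSpace Ω] (P : Measure Ω) [IsProbabilityMeasure P]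
    (B : ℕ) (hB : 1 ≤ B) (err : ℕ → ℕ → ℝ) (T : ℕ → ℕ → Ω → ℕ)
    (Δ₀ d₀ : ℕ) (hd₀ : 1 ≤ d₀ ∧ d₀ ≤ B)
    -- transmission times: positive, i.i.d. for each feature length, with finite mean
    (hT_meas : ∀ i l, 1 ≤ l → l ≤ B → Measurable (T i l))
    (hT_pos : ∀ i l ω, 1 ≤ l → l ≤ B → 1 ≤ T i l ω)
    (hT_indep : ∀ len : ℕ → ℕ, (∀ i, 1 ≤ len i ∧ len i ≤ B) →
      iIndepFun (fun i ω => T i (len i) ω) P)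
    (hT_ident : ∀ i l, 1 ≤ l → l ≤ B → IdentDistrib (T i l) (T 0 l) P P)
    (hT_mean : ∀ i l, 1 ≤ l → l ≤ B → Integrable (fun ω => (T i l ω : ℝ)) P)
    -- the inference error is bounded below, and accumulates a finite mean over two transmissions
    (herr_below : ∃ M : ℝ, ∀ δ d, 1 ≤ d → d ≤ B → M ≤ err δ d)
    (herr_int : ∀ l l' d m, 1 ≤ l → l ≤ B → 1 ≤ l' → l' ≤ B → 1 ≤ d → d ≤ B →
      Integrable (fun ω => ∑ k ∈ Finset.range (T 0 l ω + T 1 l' ω + m), |err k d|) P)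
    -- sending is not worse than never sending again
    (hworth : ∀ l b, RemoteInference.Admissible B l b →
      RemoteInference.WorthSending P err T l b) :
    ∃ (β : ℕ → ℕ → ℝ) (pinv : ℝ),
      -- `β b l` is the unique root
      (∀ l b, RemoteInference.Admissible B l b →
        RemoteInference.IsRenewalRoot P err T l b (β b l) ∧
        ∀ x : ℝ, RemoteInference.IsRenewalRoot P err T l b x → x = β b l) ∧
      -- the optimal value is the minimum of the roots
      RemoteInference.optimalValue P err T B Δ₀ d₀ = (pinv : EReal) ∧
      IsLeast {x : ℝ | ∃ l b, RemoteInference.Admissible B l b ∧ x = β b l} pinv ∧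
      -- each minimizing pair gives an optimal policy of threshold type
      ∀ lopt bopt, RemoteInference.Admissible B lopt bopt →
        (∀ l b, RemoteInference.Admissible B l b → β bopt lopt ≤ β b l) →
        ∃ π ∈ RemoteInference.timeInvariantPolicies B,
          RemoteInference.avgError P err T Δ₀ d₀ π
            = RemoteInference.optimalValue P err T B Δ₀ d₀ ∧
          (∀ ω i, RemoteInference.featLen T π ω (i + 1) = lopt ∧
            RemoteInference.featPos T π ω (i + 1) = bopt) ∧
          ∀ᵐ ω ∂P, ∀ i, RemoteInference.featLen T π ω i = lopt →
            RemoteInference.featPos T π ω i = bopt →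
            IsLeast {t : ℕ | RemoteInference.sendTime T π ω i + T i lopt ω ≤ t ∧
                pinv ≤ RemoteInference.gittins P err T lopt
                  (t - RemoteInference.sendTime T π ω i + bopt) lopt}
              (RemoteInference.sendTime T π ω (i + 1)) := by

  obtain ⟨M, hM⟩ := herr_below
  have H : RemoteInference.IsModel P B err T M :=
    ⟨hT_meas, hT_pos, hT_indep, hT_ident, hT_mean, hM, herr_int⟩
  let β : ℕ → ℕ → ℝ := fun b l =>
    RemoteInference.rootValue (P.map (T 0 l)) (fun k => err k l) b
  have hle : ∀ {l b}, RemoteInference.Admissible B l b → l ≤ B := fun h =>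
    (Nat.le_add_left _ _).trans h.2
  have hroot : ∀ l b, RemoteInference.Admissible B l b →
      RemoteInference.IsRoot (P.map (T 0 l)) (fun k => err k l) b (β b l) := fun l b h => by
    have := H.isProbabilityMeasure_law h.1 (hle h)
    exact (H.isServiceLaw h.1 (hle h) h.1 (hle h)).isRoot_rootValue
      (H.exists_feasible_of_worthSending h.1 (hle h) (hworth l b h))
  have hidle : ∀ l b, RemoteInference.Admissible B l b → ((β b l : ℝ) : EReal) ≤
      liminf (fun n : ℕ => (((1 / (n : ℝ)) * ∑ k ∈ Finset.range n, err k l : ℝ) : EReal)) atTop :=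
    fun l b h => by
    have := H.isProbabilityMeasure_law h.1 (hle h)
    exact (H.isServiceLaw h.1 (hle h) h.1 (hle h)).rootValue_le_liminf
      (H.exists_feasible_of_worthSending h.1 (hle h) (hworth l b h))
  have hadm1 : RemoteInference.Admissible B 1 0 := ⟨le_rfl, by omega⟩
  obtain ⟨l₁, b₁, hadm, hmin⟩ : ∃ l₁ b₁, RemoteInference.Admissible B l₁ b₁ ∧
      ∀ l b, RemoteInference.Admissible B l b → β b₁ l₁ ≤ β b l := by
    have hfin : {q : ℕ × ℕ | RemoteInference.Admissible B q.1 q.2}.Finite :=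
      ((Set.finite_Iic B).prod (Set.finite_Iic B)).subset fun q hq =>
        ⟨hle hq, (Nat.le_add_right _ _).trans hq.2⟩
    obtain ⟨q, hq, hqmin⟩ := Set.exists_min_image _ (fun q : ℕ × ℕ => β q.2 q.1) hfin
      ⟨(1, 0), hadm1⟩
    exact ⟨q.1, q.2, hq, fun l b h => hqmin (l, b) h⟩
  have hlower : ∀ π ∈ RemoteInference.timeInvariantPolicies B,
      ((β b₁ l₁ : ℝ) : EReal) ≤ RemoteInference.avgError P err T Δ₀ d₀ π := by
    rintro π ⟨l, hl, hlB, hπ⟩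
    by_contra! hlt
    obtain ⟨x, hx1, hx2⟩ := EReal.lt_iff_exists_real_btwn.1 hlt
    -- The minimum of the roots is at most the idle error of every length. The drift is needed for
    -- length 1 too, since feature 0 may be kept for a long time.
    have hdrift : ∀ l, 1 ≤ l → l ≤ B → RemoteInference.HasDrift (fun k => err k l) x :=
      fun l hl hlB => by
      have h : RemoteInference.Admissible B l 0 := ⟨hl, by omega⟩
      refine RemoteInference.hasDrift_of_lt_liminf (hx2.trans_le (le_trans ?_ (hidle l 0 h)))
      exact_mod_cast hmin l 0 h
    refine absurd hx1 (not_lt.2 (H.le_avgError hl hlB hπ hd₀ Δ₀ (hdrift 1 le_rfl hB)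
      (hdrift l hl hlB) fun b hb => ?_))
    have hx2' : x < β b₁ l₁ := by exact_mod_cast hx2
    exact hx2'.trans_le (hmin l b ⟨hl, hb⟩)
  have hopt : RemoteInference.optimalValue P err T B Δ₀ d₀ = ((β b₁ l₁ : ℝ) : EReal) := by
    obtain ⟨π, hπ, hle', -⟩ := H.exists_threshold_policy hadm (hroot _ _ hadm) hd₀ Δ₀
    exact le_antisymm ((iInf₂_le π hπ).trans hle') (le_iInf₂ hlower)
  refine ⟨β, β b₁ l₁, fun l b h => ⟨?_, fun x hx => ?_⟩, hopt, ⟨⟨l₁, b₁, hadm, rfl⟩, ?_⟩, ?_⟩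
  · exact (H.isRenewalRoot_iff h.1 (hle h)).2 (hroot l b h)
  · have := H.isProbabilityMeasure_law h.1 (hle h)
    exact (H.isServiceLaw h.1 (hle h) h.1 (hle h)).root_unique
      ((H.isRenewalRoot_iff h.1 (hle h)).1 hx) (hroot l b h)
  · rintro _ ⟨l, b, h, rfl⟩
    exact hmin l b h
  · intro lopt bopt h hbest
    have heq : β bopt lopt = β b₁ l₁ := le_antisymm (hbest _ _ hadm) (hmin _ _ h)
    obtain ⟨π, hπ, hle', hfeat, hae⟩ := H.exists_threshold_policy h (heq ▸ hroot _ _ h) hd₀ Δ₀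
    exact ⟨π, hπ, by rw [hopt]; exact le_antisymm hle' (hlower π hπ), hfeat, hae⟩
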